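/- Let $\mathbf U=\mathbf U_q(\mathfrak{sl}_2)$ be the $\mathbb Q(q)$-algebra with generators $E,F,K^{\pm1}$ and relations $KK^{-1}=K^{-1}K=1$, $KE=q^2EK$, $KF=q^{-2}FK$, $EF-FE=\frac{K-K^{-1}}{q-q^{-1}}$. Let $\dot{\mathbf U}$ be Lusztig's idempotented form, obtained from $\mathbf U$ by adjoining idempotents $1_n$ ($n\in\mathbb Z$) with $1_n1_m=\delta_{n,m}1_n$, $K1_n=1_nK=q^n1_n$, $E1_n=1_{n+2}E$, $F1_n=1_{n-2}F$; it is spanned by the elements $u1_n$ with $u\in\mathbf U$, $n\in\mathbb Z$. Put $[a]=\frac{q^a-q^{-a}}{q-q^{-1}}$, $[a]!=[a][a-1]\cdots[1]$ (with $[0]!=1$), $E^{(a)}=E^a/[a]!$, $F^{(a)}=F^a/[a]!$ and $g(a)=\prod_{j=1}^a\frac1{1-q^{2j}}$. Let $\bar{\ }$ be the field automorphism of $\mathbb Q(q)$ with $\bar q=q^{-1}$. Let $\rho$ be the $\mathbb Q(q)$-linear algebra antiautomorphism with $\rho(E)=qKF$, $\rho(F)=qK^{-1}E$, $\rho(K)=K$,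 and let $\psi$ be the $\bar{\ }$-antilinear algebra automorphism of $\dot{\mathbf U}$ with $\psi(E)=E$, $\psi(F)=F$, $\psi(K)=K^{-1}$, $\psi(1_n)=1_n$. Let $(\,,)\colon\dot{\mathbf U}\times\dot{\mathbf U}\to\mathbb Q(q)$ be Lusztig's bilinear form, that is, the unique symmetric bilinear form such that $(1_nx1_m,1_{n'}y1_{m'})=0$ unless $n=n'$ and $m=m'$, $(ux,y)=(x,\rho(u)y)$ for $u\in\mathbf U$, and $(E^{(a)}1_n,E^{(a)}1_n)=(F^{(a)}1_n,F^{(a)}1_n)=\prod_{s=1}^a\frac1{1-q^{-2s}}$. Define the semilinear form by $\langle x,y\rangle=\overline{(x,\psi(y))}$. Then for all integers $a,b,c,d\ge0$ with $a-b=c-d$ and all $n\in\mathbb Z$, $$\langle E^{(a)}F^{(b)}1_n,\,E^{(c)}F^{(d)}1_n\rangle=\sum_{j=\max(0,a-c)}^{\min(a,b)}q^{2j^2+(a-d+n)(a-c-2j)}\,g(a-j)\,g(b-j)\,g(j)\,g(c-a+j),$$ $$\langle F^{(b)}E^{(a)}1_n,\,F^{(d)}E^{(c)}1_n\rangle=\sum_{j=\max(0,a-c)}^{\min(a,b)}q^{2j^2+(b-c-n)(b-d-2j)}\,g(a-j)\,g(b-j)\,g(j)\,g(c-a+j).$$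 -/

import Mathlib

noncomputable section

namespace QuantumSl2

/-- The field `ℚ(q)` of rational functions in one variable. -/
abbrev Qq : Type := RatFunc ℚ

/-- The variable `q`. -/
def q : Qq := RatFunc.X

theorem q_ne_zero : q ≠ 0 := RatFunc.X_ne_zero

theorem transcendental_q : Transcendental ℚ q := by
  convert RatFunc.transcendental_X (K := ℚ) using 1
  · exact Subsingleton.elim _ _
  · rfl

theorem transcendental_q_inv : Transcendental ℚ q⁻¹ := fun h =>
  transcendental_q (IsAlgebraic.inv_iff.mp h)

theorem q_zpow_ne_one {k : ℕ} (hk : 0 < k) : q ^ k ≠ 1 := by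
  intro h
  refine transcendental_q ⟨Polynomial.X ^ k - 1, ?_, by simp [h]⟩
  exact Polynomial.X_pow_sub_C_ne_zero hk (1 : ℚ)

theorem q_sub_ne_zero : q - q⁻¹ ≠ 0 := by
  intro h
  apply q_zpow_ne_one (k := 2) (by norm_num)
  have := q_ne_zero
  field_simp at h
  linear_combination h

/-- The bar involution of `ℚ(q)`: the `ℚ`-linear field automorphism with `q ↦ q⁻¹`. -/
def bar : Qq →+* Qq :=
  RatFunc.liftRingHom (Polynomial.aeval (R := ℚ) q⁻¹ : Polynomial ℚ →+* Qq) (by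
    intro p hp
    rw [Submonoid.mem_comap, mem_nonZeroDivisors_iff_ne_zero]
    intro h
    exact nonZeroDivisors.ne_zero hp
      ((transcendental_iff.mp transcendental_q_inv) p h))

theorem bar_q : bar q = q⁻¹ := by
  have h : q = algebraMap (Polynomial ℚ) Qq Polynomial.X := RatFunc.algebraMap_X.symm
  refine (congrArg bar h).trans ?_
  rw [bar, RatFunc.liftRingHom_algebraMap]
  simp

/-- The quantum integer `[a] = (q ^ a - q ^ (-a)) / (q - q⁻¹)`. -/
def qInt (a : ℤ) : Qq := (q ^ a - q ^ (-a)) / (q - q⁻¹)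

/-- The quantum factorial `[a]! = [a] [a - 1] ⋯ [1]` (with `[0]! = 1`). -/
def qFactorial (a : ℕ) : Qq := ∏ s ∈ Finset.Icc 1 a, qInt s

/-- `g(a) = ∏_{j = 1}^a 1 / (1 - q ^ (2 j))`. -/
def g (a : ℕ) : Qq := ∏ j ∈ Finset.Icc 1 a, 1 / (1 - q ^ (2 * j))

/-- The symbols `E`, `F`, `K`, `K⁻¹` and `1_n` (`n ∈ ℤ`). -/
inductive Gen : Type
  | E : Gen
  | F : Gen
  | K : Gen
  | Kinv : Gen
  | idem (n : ℤ) : Gen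

open FreeAlgebra in
/-- The defining relations of `U_q(sl₂)` (the first five), followed by those imposed on the adjoined
idempotents `1_n`. -/
inductive Rel : FreeAlgebra Qq Gen → FreeAlgebra Qq Gen → Prop
  | K_Kinv : Rel (ι Qq .K * ι Qq .Kinv) 1
  | Kinv_K : Rel (ι Qq .Kinv * ι Qq .K) 1
  | K_E : Rel (ι Qq .K * ι Qq .E) (q ^ (2 : ℤ) • (ι Qq .E * ι Qq .K))
  | K_F : Rel (ι Qq .K * ι Qq .F) (q ^ (-2 : ℤ) • (ι Qq .F * ι Qq .K))
  | E_F : Rel (ι Qq .E * ι Qq .F - ι Qq .F * ι Qq .E)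
      ((q - q⁻¹)⁻¹ • (ι Qq .K - ι Qq .Kinv))
  | idem_idem (n m : ℤ) : Rel (ι Qq (.idem n) * ι Qq (.idem m)) (if n = m then ι Qq (.idem n) else 0)
  | K_idem (n : ℤ) : Rel (ι Qq .K * ι Qq (.idem n)) (q ^ n • ι Qq (.idem n))
  | idem_K (n : ℤ) : Rel (ι Qq (.idem n) * ι Qq .K) (q ^ n • ι Qq (.idem n))
  | E_idem (n : ℤ) : Rel (ι Qq .E * ι Qq (.idem n)) (ι Qq (.idem (n + 2)) * ι Qq .E)
  | F_idem (n : ℤ) : Rel (ι Qq .F * ι Qq (.idem n)) (ι Qq (.idem (n - 2)) * ι Qq .F)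

/-- The unital `ℚ(q)`-algebra obtained from `U = U_q(sl₂)` by adjoining the orthogonal idempotents
`1_n`. As a vector space it is `U ⊕ U̇`. -/
abbrev UI : Type := RingQuot Rel

/-- The image of a generator in `UI`. -/
def gen (x : Gen) : UI := RingQuot.mkAlgHom Qq Rel (FreeAlgebra.ι Qq x)

def E : UI := gen .E
def F : UI := gen .F
def K : UI := gen .K
def Kinv : UI := gen .Kinv
/-- The idempotent `1_n`. -/
def one (n : ℤ) : UI := gen (.idem n)

/-- The algebra `U̇`, as an ideal of `UI`: the span of all `u 1_n`. By `mul_mem_Udot` it is a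
two-sided ideal, the one generated by the idempotents `1_n`. -/
def Udot : Ideal UI := Ideal.span (Set.range one)

/-- The divided power `E^(a)`. -/
def Ediv (a : ℕ) : UI := (qFactorial a)⁻¹ • E ^ a

/-- The divided power `F^(a)`. -/
def Fdiv (a : ℕ) : UI := (qFactorial a)⁻¹ • F ^ a

theorem mul_one_mem (u : UI) (n : ℤ) : u * one n ∈ Udot :=
  Udot.mul_mem_left u (Ideal.subset_span ⟨n, rfl⟩)

/-- The element `u 1_n` of `U̇`. -/
def atWeight (u : UI) (n : ℤ) : Udot := ⟨u * one n, mul_one_mem u n⟩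

/-! ### Universal property of `UI` -/

/-- The images of the generators under a map `f` satisfy the defining relations. -/
structure IsRep {A : Type*} [Ring A] [Algebra Qq A] (f : Gen → A) : Prop where
  K_Kinv : f .K * f .Kinv = 1
  Kinv_K : f .Kinv * f .K = 1
  K_E : f .K * f .E = q ^ (2 : ℤ) • (f .E * f .K)
  K_F : f .K * f .F = q ^ (-2 : ℤ) • (f .F * f .K)
  E_F : f .E * f .F - f .F * f .E = (q - q⁻¹)⁻¹ • (f .K - f .Kinv)
  idem_idem (n m : ℤ) : f (.idem n) * f (.idem m) = if n = m then f (.idem n) else 0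
  K_idem (n : ℤ) : f .K * f (.idem n) = q ^ n • f (.idem n)
  idem_K (n : ℤ) : f (.idem n) * f .K = q ^ n • f (.idem n)
  E_idem (n : ℤ) : f .E * f (.idem n) = f (.idem (n + 2)) * f .E
  F_idem (n : ℤ) : f .F * f (.idem n) = f (.idem (n - 2)) * f .F

theorem isRep_gen : IsRep gen where
  K_Kinv := by simpa [gen] using RingQuot.mkAlgHom_rel Qq Rel.K_Kinv
  Kinv_K := by simpa [gen] using RingQuot.mkAlgHom_rel Qq Rel.Kinv_K
  K_E := by simpa [gen] using RingQuot.mkAlgHom_rel Qq Rel.K_E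
  K_F := by simpa [gen] using RingQuot.mkAlgHom_rel Qq Rel.K_F
  E_F := by simpa [gen] using RingQuot.mkAlgHom_rel Qq Rel.E_F
  idem_idem n m := by
    have := RingQuot.mkAlgHom_rel Qq (Rel.idem_idem n m)
    split_ifs at this ⊢ <;> simpa [gen] using this
  K_idem n := by simpa [gen] using RingQuot.mkAlgHom_rel Qq (Rel.K_idem n)
  idem_K n := by simpa [gen] using RingQuot.mkAlgHom_rel Qq (Rel.idem_K n)
  E_idem n := by simpa [gen] using RingQuot.mkAlgHom_rel Qq (Rel.E_idem n)
  F_idem n := by simpa [gen] using RingQuot.mkAlgHom_rel Qq (Rel.F_idem n)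

/-- The algebra homomorphism out of `UI` with prescribed values on the generators. -/
def liftHom {A : Type*} [Ring A] [Algebra Qq A] (f : Gen → A) (hf : IsRep f) : UI →ₐ[Qq] A :=
  RingQuot.liftAlgHom Qq ⟨FreeAlgebra.lift Qq f, by
    intro x y h
    cases h with
    | K_Kinv => simpa using hf.K_Kinv
    | Kinv_K => simpa using hf.Kinv_K
    | K_E => simpa using hf.K_E
    | K_F => simpa using hf.K_F
    | E_F => simpa using hf.E_F
    | idem_idem n m =>
      have := hf.idem_idem n m
      split_ifs at this ⊢ <;> simpa using this
    | K_idem n => simpa using hf.K_idem n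
    | idem_K n => simpa using hf.idem_K n
    | E_idem n => simpa using hf.E_idem n
    | F_idem n => simpa using hf.F_idem n⟩

theorem liftHom_gen {A : Type*} [Ring A] [Algebra Qq A] (f : Gen → A) (hf : IsRep f) (x : Gen) :
    liftHom f hf (gen x) = f x := by
  simp [liftHom, gen]

/-- Induction principle for `UI`. -/
theorem UI_induction {P : UI → Prop} (h0 : ∀ c : Qq, P (algebraMap Qq UI c)) (h1 : ∀ x, P (gen x))
    (hmul : ∀ a b, P a → P b → P (a * b)) (hadd : ∀ a b, P a → P b → P (a + b)) (u : UI) : P u := by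
  obtain ⟨u, rfl⟩ := RingQuot.mkAlgHom_surjective Qq Rel u
  induction u using FreeAlgebra.induction with
  | grade0 c => simpa using h0 c
  | grade1 x => exact h1 x
  | mul a b ha hb => simpa using hmul _ _ ha hb
  | add a b ha hb => simpa using hadd _ _ ha hb

theorem K_mul_Kinv : K * Kinv = 1 := isRep_gen.K_Kinv
theorem Kinv_mul_K : Kinv * K = 1 := isRep_gen.Kinv_K
theorem K_mul_E : K * E = q ^ (2 : ℤ) • (E * K) := isRep_gen.K_E
theorem K_mul_F : K * F = q ^ (-2 : ℤ) • (F * K) := isRep_gen.K_F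
theorem E_F_comm : E * F - F * E = (q - q⁻¹)⁻¹ • (K - Kinv) := isRep_gen.E_F
theorem one_mul_one (n m : ℤ) : one n * one m = if n = m then one n else 0 :=
  isRep_gen.idem_idem n m
theorem K_mul_one (n : ℤ) : K * one n = q ^ n • one n := isRep_gen.K_idem n
theorem one_mul_K (n : ℤ) : one n * K = q ^ n • one n := isRep_gen.idem_K n
theorem E_mul_one (n : ℤ) : E * one n = one (n + 2) * E := isRep_gen.E_idem n
theorem F_mul_one (n : ℤ) : F * one n = one (n - 2) * F := isRep_gen.F_idem n

theorem Kinv_mul_one (n : ℤ) : Kinv * one n = q ^ (-n) • one n := by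
  have h : Kinv * (K * one n) = one n := by rw [← mul_assoc, Kinv_mul_K, one_mul]
  rw [K_mul_one, mul_smul_comm] at h
  conv_rhs => rw [← h, smul_smul, ← zpow_add₀ q_ne_zero]
  simp

theorem one_mul_Kinv (n : ℤ) : one n * Kinv = q ^ (-n) • one n := by
  have h : one n * K * Kinv = one n := by rw [mul_assoc, K_mul_Kinv, mul_one]
  rw [one_mul_K, smul_mul_assoc] at h
  conv_rhs => rw [← h, smul_smul, ← zpow_add₀ q_ne_zero]
  simp

theorem mul_mem_Udot (x : UI) (hx : x ∈ Udot) (u : UI) : x * u ∈ Udot := by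
  have key : ∀ u : UI, ∀ n : ℤ, one n * u ∈ Udot := by
    intro u
    induction u using UI_induction with
    | h0 c =>
      intro n
      rw [← Algebra.commutes]
      exact mul_one_mem _ _
    | h1 y =>
      intro n
      cases y with
      | E =>
        have := E_mul_one (n - 2)
        rw [sub_add_cancel] at this
        change one n * E ∈ _
        exact this ▸ mul_one_mem _ _
      | F =>
        have := F_mul_one (n + 2)
        rw [add_sub_cancel_right] at this
        change one n * F ∈ _
        exact this ▸ mul_one_mem _ _
      | K =>
        change one n * K ∈ _
        rw [one_mul_K, ← K_mul_one]
        exact mul_one_mem _ _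
      | Kinv =>
        change one n * Kinv ∈ _
        rw [one_mul_Kinv, ← Kinv_mul_one]
        exact mul_one_mem _ _
      | idem m => exact mul_one_mem _ m
    | hmul a b ha hb =>
      intro n
      have := ha n
      rw [← mul_assoc]
      rw [Udot] at this
      generalize one n * a = z at this
      induction this using Submodule.span_induction with
      | mem y hy => obtain ⟨m, rfl⟩ := hy; exact hb m
      | zero => simp
      | add y z _ _ hy hz => rw [add_mul]; exact add_mem hy hz
      | smul r y _ hy => rw [smul_eq_mul, mul_assoc]; exact Udot.mul_mem_left r hy
    | hadd a b ha hb => intro n; rw [mul_add]; exact add_mem (ha n) (hb n)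
  rw [Udot] at hx
  induction hx using Submodule.span_induction with
  | mem y hy => obtain ⟨m, rfl⟩ := hy; exact key u m
  | zero => simp
  | add y z _ _ hy hz => rw [add_mul]; exact add_mem hy hz
  | smul r y _ hy => rw [smul_eq_mul, mul_assoc]; exact Udot.mul_mem_left r hy

/-! ### The antiautomorphism `ρ` and the antilinear automorphism `ψ` -/

open MulOpposite in
/-- Values of `ρ` on the generators. -/
def rhoGen : Gen → UIᵐᵒᵖ
  | .E => op (q • (K * F))
  | .F => op (q • (Kinv * E))
  | .K => op K
  | .Kinv => op Kinv
  | .idem n => op (one n)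

theorem Kinv_mul_E : Kinv * E = q ^ (-2 : ℤ) • (E * Kinv) := by
  have h : Kinv * (K * E) * Kinv = E * Kinv := by rw [← mul_assoc, Kinv_mul_K, one_mul]
  rw [K_mul_E, mul_smul_comm, smul_mul_assoc, ← mul_assoc, mul_assoc, K_mul_Kinv, mul_one] at h
  rw [← h, smul_smul, ← zpow_add₀ q_ne_zero]
  simp

theorem Kinv_mul_F : Kinv * F = q ^ (2 : ℤ) • (F * Kinv) := by
  have h : Kinv * (K * F) * Kinv = F * Kinv := by rw [← mul_assoc, Kinv_mul_K, one_mul]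
  rw [K_mul_F, mul_smul_comm, smul_mul_assoc, ← mul_assoc, mul_assoc, K_mul_Kinv, mul_one] at h
  rw [← h, smul_smul, ← zpow_add₀ q_ne_zero]
  simp

theorem E_mul_Kinv : E * Kinv = q ^ (2 : ℤ) • (Kinv * E) := by
  rw [Kinv_mul_E, smul_smul, ← zpow_add₀ q_ne_zero]; simp

theorem F_mul_K : F * K = q ^ (2 : ℤ) • (K * F) := by
  rw [K_mul_F, smul_smul, ← zpow_add₀ q_ne_zero]; simp

theorem isRep_rho : IsRep rhoGen where
  K_Kinv := by
    apply MulOpposite.unop_injective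
    exact Kinv_mul_K
  Kinv_K := by
    apply MulOpposite.unop_injective
    exact K_mul_Kinv
  K_E := by
    apply MulOpposite.unop_injective
    change q • (K * F) * K = q ^ (2 : ℤ) • (K * q • (K * F))
    rw [smul_mul_assoc, mul_assoc, F_mul_K, mul_smul_comm, mul_smul_comm, smul_comm]
  K_F := by
    apply MulOpposite.unop_injective
    change q • (Kinv * E) * K = q ^ (-2 : ℤ) • (K * q • (Kinv * E))
    rw [mul_smul_comm, ← mul_assoc K, K_mul_Kinv, one_mul, Kinv_mul_E, smul_mul_assoc,
      smul_mul_assoc, mul_assoc, Kinv_mul_K, mul_one, smul_comm]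
  E_F := by
    apply MulOpposite.unop_injective
    change q • (Kinv * E) * q • (K * F) - q • (K * F) * q • (Kinv * E)
      = (q - q⁻¹)⁻¹ • (K - Kinv)
    rw [← E_F_comm]
    congr 1
    · rw [smul_mul_smul_comm, Kinv_mul_E, smul_mul_assoc, ← mul_assoc, mul_assoc E, Kinv_mul_K,
        mul_one, smul_smul]
      have : q * q * q ^ (-2 : ℤ) = 1 := by
        have := q_ne_zero
        rw [zpow_neg]; field_simp
      rw [this, one_smul]
    · rw [smul_mul_smul_comm, K_mul_F, smul_mul_assoc, ← mul_assoc, mul_assoc F, K_mul_Kinv,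
        mul_one, smul_smul]
      have : q * q * q ^ (-2 : ℤ) = 1 := by
        have := q_ne_zero
        rw [zpow_neg]; field_simp
      rw [this, one_smul]
  idem_idem n m := by
    apply MulOpposite.unop_injective
    change one m * one n = MulOpposite.unop (if n = m then rhoGen (.idem n) else 0)
    rw [one_mul_one]
    split_ifs with h1 h2 h2
    · subst h1; rfl
    · exact absurd h1.symm h2
    · exact absurd h2.symm h1
    · rfl
  K_idem n := by
    apply MulOpposite.unop_injective
    exact one_mul_K n
  idem_K n := by
    apply MulOpposite.unop_injective
    exact K_mul_one n
  E_idem n := by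
    apply MulOpposite.unop_injective
    change one n * q • (K * F) = q • (K * F) * one (n + 2)
    have h := F_mul_one (n + 2)
    rw [add_sub_cancel_right] at h
    rw [smul_mul_assoc, mul_assoc, h, mul_smul_comm, ← mul_assoc, ← mul_assoc, one_mul_K, K_mul_one]
  F_idem n := by
    apply MulOpposite.unop_injective
    change one n * q • (Kinv * E) = q • (Kinv * E) * one (n - 2)
    have h := E_mul_one (n - 2)
    rw [sub_add_cancel] at h
    rw [smul_mul_assoc, mul_assoc, h, mul_smul_comm, ← mul_assoc, ← mul_assoc, one_mul_Kinv,
      Kinv_mul_one]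

/-- The linear antiautomorphism `ρ`, with `ρ(E) = q K F`, `ρ(F) = q K⁻¹ E`, `ρ(K) = K` and
`ρ(1_n) = 1_n`, as a homomorphism to the opposite algebra. -/
def rhoHom : UI →ₐ[Qq] UIᵐᵒᵖ := liftHom rhoGen isRep_rho

/-- The antiautomorphism `ρ` as a map from `UI` to itself. -/
def rho (u : UI) : UI := MulOpposite.unop (rhoHom u)

/-- The ring `UI`, on which `f ∈ ℚ(q)` acts as multiplication by its conjugate `bar f`. -/
def UIbar : Type := UI

instance : Ring UIbar := inferInstanceAs (Ring UI)

instance : Algebra Qq UIbar :=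
  ((algebraMap Qq UI).comp bar).toAlgebra' fun c x =>
    Algebra.commutes (R := Qq) (A := UI) (bar c) x

theorem UIbar_smul (c : Qq) (x : UI) :
    (HSMul.hSMul (α := Qq) (β := UIbar) (γ := UIbar) c x : UI) = bar c • x := by
  rw [Algebra.smul_def (R := Qq) (A := UI) (bar c) x]
  rfl

/-- Values of `ψ` on the generators. -/
def psiGen : Gen → UIbar
  | .E => E
  | .F => F
  | .K => Kinv
  | .Kinv => K
  | .idem n => one n

theorem isRep_psi : IsRep psiGen where
  K_Kinv := Kinv_mul_K
  Kinv_K := K_mul_Kinv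
  K_E := by
    refine Eq.trans ?_ (UIbar_smul _ (E * Kinv)).symm
    change Kinv * E = _
    rw [Kinv_mul_E, map_zpow₀, bar_q, inv_zpow, zpow_neg]
  K_F := by
    refine Eq.trans ?_ (UIbar_smul _ (F * Kinv)).symm
    change Kinv * F = _
    rw [Kinv_mul_F, map_zpow₀, bar_q, inv_zpow, zpow_neg, inv_inv]
  E_F := by
    refine Eq.trans ?_ (UIbar_smul _ (Kinv - K)).symm
    change E * F - F * E = _
    rw [E_F_comm, map_inv₀, map_sub, map_inv₀, bar_q, inv_inv, ← neg_sub q, ← neg_sub K, inv_neg,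
      neg_smul_neg]
  idem_idem n m := one_mul_one n m
  K_idem n := by
    refine Eq.trans ?_ (UIbar_smul _ (one n)).symm
    change Kinv * one n = _
    rw [Kinv_mul_one, map_zpow₀, bar_q, inv_zpow, zpow_neg]
  idem_K n := by
    refine Eq.trans ?_ (UIbar_smul _ (one n)).symm
    change one n * Kinv = _
    rw [one_mul_Kinv, map_zpow₀, bar_q, inv_zpow, zpow_neg]
  E_idem n := E_mul_one n
  F_idem n := F_mul_one n

/-- The antilinear algebra automorphism `ψ` with `ψ(E) = E`, `ψ(F) = F`, `ψ(K) = K⁻¹` and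
`ψ(1_n) = 1_n`. -/
def psi : UI →+* UI := (liftHom (A := UIbar) psiGen isRep_psi).toRingHom

theorem psi_gen (x : Gen) : psi (gen x) = psiGen x :=
  liftHom_gen (A := UIbar) psiGen isRep_psi x

theorem psi_smul (c : Qq) (x : UI) : psi (c • x) = bar c • psi x :=
  (map_smul (liftHom (A := UIbar) psiGen isRep_psi) c x).trans (UIbar_smul c (psi x))

theorem psi_mem (x : UI) (hx : x ∈ Udot) : psi x ∈ Udot := by
  rw [Udot] at hx
  induction hx using Submodule.span_induction with
  | mem y hy =>
    obtain ⟨m, rfl⟩ := hy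
    have : psi (one m) = one m := psi_gen _
    rw [this]
    exact Ideal.subset_span ⟨m, rfl⟩
  | zero => simp
  | add y z _ _ hy hz => rw [map_add]; exact add_mem hy hz
  | smul r y _ hy => rw [smul_eq_mul, map_mul]; exact Udot.mul_mem_left _ hy

/-- The restriction of `ψ` to `U̇`. -/
def psiDot (x : Udot) : Udot := ⟨psi x, psi_mem x x.2⟩

/-! ### The bilinear and the semilinear form -/

/-- The properties of Lusztig's bilinear form `(,)` on `U̇`. In `adjoint`, `u` is any element of the
algebra `UI`, in particular of `U`. -/
structure IsLusztigForm (B : Udot →ₗ[Qq] Udot →ₗ[Qq] Qq) : Prop where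
  /-- `(1_n x 1_m, 1_n' y 1_m') = 0` unless `n = n'` and `m = m'` -/
  orthogonal : ∀ (n m n' m' : ℤ) (x y : Udot), one n * (x : UI) * one m = x →
    one n' * (y : UI) * one m' = y → ¬ (n = n' ∧ m = m') → B x y = 0
  adjoint : ∀ (u : UI) (x y : Udot), B (u • x) y = B x (rho u • y)
  norm_E : ∀ (a : ℕ) (n : ℤ), B (atWeight (Ediv a) n) (atWeight (Ediv a) n) =
    ∏ s ∈ Finset.Icc 1 a, 1 / (1 - q ^ (-2 * (s : ℤ)))
  norm_F : ∀ (a : ℕ) (n : ℤ), B (atWeight (Fdiv a) n) (atWeight (Fdiv a) n) =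
    ∏ s ∈ Finset.Icc 1 a, 1 / (1 - q ^ (-2 * (s : ℤ)))
  symm : ∀ x y : Udot, B x y = B y x


/-! ### Existence and uniqueness of the bilinear form -/

theorem rho_mul (u v : UI) : rho (u * v) = rho v * rho u := by
  simp [rho]

theorem rho_add (u v : UI) : rho (u + v) = rho u + rho v := by
  simp [rho]

theorem rho_smul (c : Qq) (u : UI) : rho (c • u) = c • rho u := by
  simp [rho]

theorem rho_pow (u : UI) (k : ℕ) : rho (u ^ k) = rho u ^ k := by
  simp [rho]

theorem rho_algebraMap (c : Qq) : rho (algebraMap Qq UI c) = algebraMap Qq UI c := by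
  simp [rho]

theorem rho_gen (x : Gen) : rho (gen x) = MulOpposite.unop (rhoGen x) :=
  congrArg MulOpposite.unop (liftHom_gen rhoGen isRep_rho x)

theorem rho_E : rho E = q • (K * F) := rho_gen .E
theorem rho_F : rho F = q • (Kinv * E) := rho_gen .F
theorem rho_K : rho K = K := rho_gen .K
theorem rho_Kinv : rho Kinv = Kinv := rho_gen .Kinv
theorem rho_one (n : ℤ) : rho (one n) = one n := rho_gen (.idem n)

theorem rho_rho (u : UI) : rho (rho u) = u := by
  induction u using UI_induction with
  | h0 c => rw [rho_algebraMap, rho_algebraMap]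
  | hmul a b ha hb => rw [rho_mul, rho_mul, ha, hb]
  | hadd a b ha hb => rw [rho_add, rho_add, ha, hb]
  | h1 x =>
    cases x with
    | E =>
      change rho (rho E) = E
      have h : E * K = q ^ (-2 : ℤ) • (K * E) := by
        rw [K_mul_E, smul_smul, ← zpow_add₀ q_ne_zero]; simp
      have h2 : q * q * q ^ (-2 : ℤ) = 1 := by
        have := q_ne_zero
        rw [zpow_neg]; field_simp
      rw [rho_E, rho_smul, rho_mul, rho_F, rho_K, smul_mul_assoc, mul_assoc, h, mul_smul_comm,
        smul_smul, smul_smul, ← mul_assoc, Kinv_mul_K, one_mul, h2, one_smul]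
    | F =>
      change rho (rho F) = F
      have h : F * Kinv = q ^ (-2 : ℤ) • (Kinv * F) := by
        rw [Kinv_mul_F, smul_smul, ← zpow_add₀ q_ne_zero]; simp
      have h2 : q * q * q ^ (-2 : ℤ) = 1 := by
        have := q_ne_zero
        rw [zpow_neg]; field_simp
      rw [rho_F, rho_smul, rho_mul, rho_E, rho_Kinv, smul_mul_assoc, mul_assoc, h, mul_smul_comm,
        smul_smul, smul_smul, ← mul_assoc, K_mul_Kinv, one_mul, h2, one_smul]
    | K => exact (congrArg rho rho_K).trans rho_K
    | Kinv => exact (congrArg rho rho_Kinv).trans rho_Kinv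
    | idem n => exact (congrArg rho (rho_one n)).trans (rho_one n)

theorem E_pow_mul_one (b : ℕ) (n : ℤ) : E ^ b * one n = one (n + 2 * b) * E ^ b := by
  induction b with
  | zero => simp
  | succ b ih =>
    rw [pow_succ', mul_assoc, ih, ← mul_assoc, E_mul_one, mul_assoc]
    congr 2
    push_cast; ring

theorem F_pow_mul_one (a : ℕ) (n : ℤ) : F ^ a * one n = one (n - 2 * a) * F ^ a := by
  induction a with
  | zero => simp
  | succ a ih =>
    rw [pow_succ', mul_assoc, ih, ← mul_assoc, F_mul_one, mul_assoc]
    congr 2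
    push_cast; ring

theorem one_mul_self (n : ℤ) : one n * one n = one n := by simp [one_mul_one]

/-- `F^a E^b 1_n` has weights `n + 2 b - 2 a` and `n`. -/
theorem weight_FE (a b : ℕ) (n : ℤ) :
    one (n + 2 * b - 2 * a) * (F ^ a * E ^ b * one n) * one n = F ^ a * E ^ b * one n := by
  have h : one (n + 2 * b - 2 * a) * (F ^ a * E ^ b * one n) = F ^ a * E ^ b * one n := by
    rw [mul_assoc, E_pow_mul_one, ← mul_assoc (F ^ a), F_pow_mul_one, ← mul_assoc, ← mul_assoc,
      one_mul_self]
  rw [h, mul_assoc, one_mul_self]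

theorem weight_left (a b : ℕ) (n : ℤ) :
    F ^ a * E ^ b * one n = one (n + 2 * b - 2 * a) * (F ^ a * E ^ b * one n) := by
  have h := weight_FE a b n
  rw [mul_assoc, mul_assoc, one_mul_self] at h
  exact h.symm

theorem mem_span_FE (y : UI) (hy : y ∈ Udot) : y ∈ Submodule.span Qq
    (Set.range fun p : ℕ × ℕ × ℤ => F ^ p.1 * E ^ p.2.1 * one p.2.2) := by
  set S := Submodule.span Qq (Set.range fun p : ℕ × ℕ × ℤ => F ^ p.1 * E ^ p.2.1 * one p.2.2)
    with hS
  have hmem : ∀ (a b : ℕ) (n : ℤ), F ^ a * E ^ b * one n ∈ S := fun a b n =>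
    Submodule.subset_span ⟨(a, b, n), rfl⟩
  have ext : ∀ u : UI, (∀ a b n, u * (F ^ a * E ^ b * one n) ∈ S) → ∀ y ∈ S, u * y ∈ S := by
    intro u hu y hy
    rw [hS] at hy
    induction hy using Submodule.span_induction with
    | mem y hy => obtain ⟨⟨a, b, n⟩, rfl⟩ := hy; exact hu a b n
    | zero => simp
    | add y z _ _ hy hz => rw [mul_add]; exact add_mem hy hz
    | smul c y _ hy => rw [mul_smul_comm]; exact S.smul_mem c hy
  have hF := ext F fun a b n => by
    rw [← mul_assoc, ← mul_assoc, ← pow_succ']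
    exact hmem _ _ _
  have hK := ext K fun a b n => by
    rw [weight_left, ← mul_assoc, K_mul_one, smul_mul_assoc, ← weight_left]
    exact S.smul_mem _ (hmem _ _ _)
  have hKinv := ext Kinv fun a b n => by
    rw [weight_left, ← mul_assoc, Kinv_mul_one, smul_mul_assoc, ← weight_left]
    exact S.smul_mem _ (hmem _ _ _)
  have hE := ext E fun a b n => by
    induction a with
    | zero =>
      rw [pow_zero, one_mul, ← mul_assoc, ← pow_succ']
      simpa using hmem 0 (b + 1) n
    | succ a ih =>
      have h := eq_add_of_sub_eq' E_F_comm
      have h2 : E * (F ^ (a + 1) * E ^ b * one n) = F * (E * (F ^ a * E ^ b * one n)) +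
          (q - q⁻¹)⁻¹ • (K * (F ^ a * E ^ b * one n) - Kinv * (F ^ a * E ^ b * one n)) := by
        rw [← sub_mul, ← smul_mul_assoc, ← mul_assoc F, ← add_mul, ← h, pow_succ']
        simp only [mul_assoc]
      rw [h2]
      exact add_mem (hF _ ih) (S.smul_mem _ (sub_mem (hK _ (hmem _ _ _)) (hKinv _ (hmem _ _ _))))
  have hone : ∀ m, ∀ y ∈ S, one m * y ∈ S := fun m => ext (one m) fun a b n => by
    rw [weight_left, ← mul_assoc, one_mul_one]
    split_ifs with h
    · subst h; rw [← weight_left]; exact hmem _ _ _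
    · simp
  have hall : ∀ u : UI, ∀ y ∈ S, u * y ∈ S := by
    intro u
    induction u using UI_induction with
    | h0 c => intro y hy; rw [← Algebra.smul_def]; exact S.smul_mem c hy
    | h1 x =>
      cases x with
      | E => exact hE
      | F => exact hF
      | K => exact hK
      | Kinv => exact hKinv
      | idem m => exact hone m
    | hmul a b ha hb => intro y hy; rw [mul_assoc]; exact ha _ (hb _ hy)
    | hadd a b ha hb => intro y hy; rw [add_mul]; exact add_mem (ha _ hy) (hb _ hy)
  rw [Udot] at hy
  induction hy using Submodule.span_induction with
  | mem y hy => obtain ⟨m, rfl⟩ := hy; simpa using hmem 0 0 m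
  | zero => simp
  | add y z _ _ hy hz => exact add_mem hy hz
  | smul r y _ hy => exact hall r y hy

theorem form_eq_zero (D : Udot →ₗ[Qq] Udot →ₗ[Qq] Qq)
    (orth : ∀ (n m n' m' : ℤ) (x y : Udot), one n * (x : UI) * one m = x →
      one n' * (y : UI) * one m' = y → ¬ (n = n' ∧ m = m') → D x y = 0)
    (adj : ∀ (u : UI) (x y : Udot), D (u • x) y = D x (rho u • y))
    (norm : ∀ (a : ℕ) (n : ℤ), D (atWeight (E ^ a) n) (atWeight (E ^ a) n) = 0) : D = 0 := by
  have step1 : ∀ (a b : ℕ) (n m : ℤ), D (atWeight 1 m) (atWeight (F ^ a * E ^ b) n) = 0 := by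
    intro a b n m
    by_cases h : m = n + 2 * b - 2 * a ∧ m = n
    · obtain ⟨h1, h2⟩ := h
      subst h2
      obtain rfl : a = b := by omega
      have hrho : rho (q⁻¹ • (E * Kinv)) = F := by
        rw [rho_smul, rho_mul, rho_E, rho_Kinv, mul_smul_comm, smul_smul,
          inv_mul_cancel₀ q_ne_zero, one_smul, ← mul_assoc, Kinv_mul_K, one_mul]
      have hs : ∃ s : Qq, (q⁻¹ • (E * Kinv)) ^ a * one m = s • (E ^ a * one m) := by
        clear h1
        induction a with
        | zero => exact ⟨1, by simp⟩
        | succ a ih =>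
          obtain ⟨s, hs⟩ := ih
          refine ⟨s * q⁻¹ * q ^ (-(m + 2 * a)), ?_⟩
          rw [pow_succ', mul_assoc, hs, mul_smul_comm, E_pow_mul_one, smul_mul_assoc, mul_assoc,
            ← mul_assoc Kinv, Kinv_mul_one, smul_mul_assoc, mul_smul_comm, smul_smul, smul_smul,
            ← E_pow_mul_one, ← mul_assoc, ← pow_succ', mul_assoc]
      obtain ⟨s, hs⟩ := hs
      have e1 : atWeight (F ^ a * E ^ a) m =
          rho ((q⁻¹ • (E * Kinv)) ^ a) • atWeight (E ^ a) m := by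
        apply Subtype.ext
        change F ^ a * E ^ a * one m = rho ((q⁻¹ • (E * Kinv)) ^ a) * (E ^ a * one m)
        rw [rho_pow, hrho, mul_assoc]
      have e2 : (q⁻¹ • (E * Kinv)) ^ a • atWeight 1 m = s • atWeight (E ^ a) m := by
        apply Subtype.ext
        change (q⁻¹ • (E * Kinv)) ^ a * (1 * one m) = s • (E ^ a * one m)
        rw [one_mul, hs]
      rw [e1, ← adj, e2, map_smul, LinearMap.smul_apply, norm, smul_zero]
    · refine orth m m (n + 2 * b - 2 * a) n _ _ ?_ (weight_FE a b n) h
      change one m * (1 * one m) * one m = 1 * one m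
      rw [one_mul, one_mul_self, one_mul_self]
  have step2 : ∀ (y : UI) (hy : y ∈ Udot) (m : ℤ), D (atWeight 1 m) ⟨y, hy⟩ = 0 := by
    intro y hy m
    have h := mem_span_FE y hy
    have key : ∀ z ∈ Submodule.span Qq
        (Set.range fun p : ℕ × ℕ × ℤ => F ^ p.1 * E ^ p.2.1 * one p.2.2),
        ∃ hz : z ∈ Udot, D (atWeight 1 m) ⟨z, hz⟩ = 0 := by
      intro z hz
      induction hz using Submodule.span_induction with
      | mem z hz => obtain ⟨⟨a, b, n⟩, rfl⟩ := hz; exact ⟨mul_one_mem _ _, step1 a b n m⟩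
      | zero => exact ⟨zero_mem _, map_zero _⟩
      | add y z _ _ hy hz =>
        obtain ⟨h1, h2⟩ := hy
        obtain ⟨h3, h4⟩ := hz
        refine ⟨add_mem h1 h3, ?_⟩
        have : (⟨y + z, add_mem h1 h3⟩ : Udot) = ⟨y, h1⟩ + ⟨z, h3⟩ := rfl
        rw [this, map_add, h2, h4, add_zero]
      | smul c y _ hy =>
        obtain ⟨h1, h2⟩ := hy
        have h3 : c • y ∈ Udot := by
          rw [Algebra.smul_def]; exact Udot.mul_mem_left _ h1
        refine ⟨h3, ?_⟩
        have : (⟨c • y, h3⟩ : Udot) = c • (⟨y, h1⟩ : Udot) := rfl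
        rw [this, map_smul, h2, smul_zero]
    obtain ⟨_, h2⟩ := key y h
    exact h2
  have step3 : ∀ (x : UI) (hx : x ∈ Udot) (y : Udot), D ⟨x, hx⟩ y = 0 := by
    intro x hx
    have key : ∀ x ∈ Ideal.span (Set.range one),
        ∃ hx : x ∈ Udot, ∀ y : Udot, D ⟨x, hx⟩ y = 0 := by
      clear hx x
      intro x h
      rw [Ideal.span] at h
      induction h using Submodule.span_induction with
      | mem x hx =>
        obtain ⟨m, rfl⟩ := hx
        refine ⟨Ideal.subset_span ⟨m, rfl⟩, fun y => ?_⟩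
        have : (⟨one m, Ideal.subset_span ⟨m, rfl⟩⟩ : Udot) = atWeight 1 m :=
          Subtype.ext (one_mul _).symm
        rw [this]
        exact step2 y y.2 m
      | zero => exact ⟨zero_mem _, fun y => by
          rw [show (⟨0, zero_mem _⟩ : Udot) = 0 from rfl, map_zero, LinearMap.zero_apply]⟩
      | add y z _ _ hy hz =>
        obtain ⟨h1, h2⟩ := hy
        obtain ⟨h3, h4⟩ := hz
        refine ⟨add_mem h1 h3, fun w => ?_⟩
        have : (⟨y + z, add_mem h1 h3⟩ : Udot) = ⟨y, h1⟩ + ⟨z, h3⟩ := rfl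
        rw [this, map_add, LinearMap.add_apply, h2, h4, add_zero]
      | smul r y _ hy =>
        obtain ⟨h1, h2⟩ := hy
        refine ⟨Udot.mul_mem_left r h1, fun w => ?_⟩
        have : (⟨r • y, Udot.mul_mem_left r h1⟩ : Udot) = r • (⟨y, h1⟩ : Udot) := rfl
        rw [this, adj, h2]
    obtain ⟨_, h⟩ := key x hx
    exact h
  ext x y
  exact step3 x x.2 y

/-! An auxiliary module: the left `UI`-module `U̇ 1_n` with basis `F^a E^b 1_n`. -/

/-- Action of the generators on the basis. -/
def modGen (n : ℤ) : Gen → Module.End Qq (ℕ × ℕ →₀ Qq)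
  | .E => Finsupp.linearCombination Qq fun p => Finsupp.single (p.1, p.2 + 1) 1 +
      (qInt p.1 * qInt (n + 2 * p.2 - p.1 + 1)) • Finsupp.single (p.1 - 1, p.2) 1
  | .F => Finsupp.linearCombination Qq fun p => Finsupp.single (p.1 + 1, p.2) 1
  | .K => Finsupp.linearCombination Qq fun p =>
      q ^ (n + 2 * p.2 - 2 * p.1 : ℤ) • Finsupp.single p 1
  | .Kinv => Finsupp.linearCombination Qq fun p =>
      q ^ (-(n + 2 * p.2 - 2 * p.1 : ℤ)) • Finsupp.single p 1
  | .idem m => Finsupp.linearCombination Qq fun p =>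
      if n + 2 * p.2 - 2 * p.1 = m then Finsupp.single p 1 else 0

/-- Basis vector. -/
def bv (a b : ℕ) : ℕ × ℕ →₀ Qq := Finsupp.single (a, b) 1

theorem modGen_E (n : ℤ) (a b : ℕ) : modGen n .E (bv a b) = bv a (b + 1) +
    (qInt a * qInt (n + 2 * b - a + 1)) • bv (a - 1) b := by
  simp only [modGen, bv, Finsupp.linearCombination_single, one_smul]

theorem modGen_F (n : ℤ) (a b : ℕ) : modGen n .F (bv a b) = bv (a + 1) b := by
  simp only [modGen, bv, Finsupp.linearCombination_single, one_smul]

theorem modGen_K (n : ℤ) (a b : ℕ) :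
    modGen n .K (bv a b) = q ^ (n + 2 * b - 2 * a : ℤ) • bv a b := by
  simp only [modGen, bv, Finsupp.linearCombination_single, one_smul]

theorem modGen_Kinv (n : ℤ) (a b : ℕ) :
    modGen n .Kinv (bv a b) = q ^ (-(n + 2 * b - 2 * a : ℤ)) • bv a b := by
  simp only [modGen, bv, Finsupp.linearCombination_single, one_smul]

theorem modGen_idem (n m : ℤ) (a b : ℕ) :
    modGen n (.idem m) (bv a b) = if n + 2 * b - 2 * a = m then bv a b else 0 := by
  simp only [modGen, bv, Finsupp.linearCombination_single, one_smul]

theorem end_ext {M : Type*} [AddCommGroup M] [Module Qq M] {f h : (ℕ × ℕ →₀ Qq) →ₗ[Qq] M}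
    (H : ∀ a b, f (bv a b) = h (bv a b)) : f = h := by
  apply Finsupp.lhom_ext'
  rintro ⟨a, b⟩
  apply LinearMap.ext_ring
  exact H a b

theorem qInt_zero : qInt 0 = 0 := by simp [qInt]

theorem isRep_mod (n : ℤ) : IsRep (modGen n) where
  K_Kinv := end_ext fun a b => by
    simp only [Module.End.mul_apply, modGen_K, modGen_Kinv, map_smul, smul_smul,
      ← zpow_add₀ q_ne_zero, Module.End.one_apply]
    simp
  Kinv_K := end_ext fun a b => by
    simp only [Module.End.mul_apply, modGen_K, modGen_Kinv, map_smul, smul_smul,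
      ← zpow_add₀ q_ne_zero, Module.End.one_apply]
    simp
  K_E := end_ext fun a b => by
    rcases a with _ | a
    · simp only [Module.End.mul_apply, LinearMap.smul_apply, modGen_K, modGen_E, map_smul, map_add,
        smul_smul, smul_add, ← zpow_add₀ q_ne_zero]
      simp only [Nat.cast_zero, qInt_zero, zero_mul, zero_smul, mul_zero, add_zero]
      congr 2
      push_cast; ring
    · simp only [Module.End.mul_apply, LinearMap.smul_apply, modGen_K, modGen_E, map_smul, map_add,
        smul_smul, smul_add, ← zpow_add₀ q_ne_zero, Nat.add_sub_cancel]
      rw [show n + 2 * ((b + 1 : ℕ) : ℤ) - 2 * ((a + 1 : ℕ) : ℤ) =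
          2 + (n + 2 * (b : ℤ) - 2 * ((a + 1 : ℕ) : ℤ)) by push_cast; ring,
        show n + 2 * (b : ℤ) - 2 * (a : ℤ) =
          2 + (n + 2 * (b : ℤ) - 2 * ((a + 1 : ℕ) : ℤ)) by push_cast; ring]
      congr 2
      rw [zpow_add₀ q_ne_zero]
      exact (mul_comm _ _).trans (mul_assoc _ _ _)
  K_F := end_ext fun a b => by
    simp only [Module.End.mul_apply, LinearMap.smul_apply, modGen_K, modGen_F, map_smul, smul_smul,
      ← zpow_add₀ q_ne_zero]
    congr 2
    push_cast; ring
  E_F := end_ext fun a b => by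
    have hq := q_ne_zero
    have hD := q_sub_ne_zero
    have key : qInt ((a : ℤ) + 1) * qInt (n + 2 * b - ((a : ℤ) + 1) + 1) -
        qInt a * qInt (n + 2 * b - a + 1) =
        (q - q⁻¹)⁻¹ * (q ^ (n + 2 * b - 2 * a : ℤ) - q ^ (-(n + 2 * b - 2 * a : ℤ))) := by
      have e1 : n + 2 * (b : ℤ) - ((a : ℤ) + 1) + 1 = (n + 2 * b) - a := by ring
      have e2 : n + 2 * (b : ℤ) - 2 * a = (n + 2 * b) - a - a := by ring
      rw [e1, e2]
      generalize n + 2 * (b : ℤ) = w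
      simp only [qInt, zpow_neg, zpow_add₀ hq, zpow_sub₀ hq, zpow_one]
      have hA : q ^ (a : ℤ) ≠ 0 := zpow_ne_zero _ hq
      have hW : q ^ w ≠ 0 := zpow_ne_zero _ hq
      generalize q ^ (a : ℤ) = A at *
      generalize q ^ w = W at *
      have hD' : q ^ 2 - 1 ≠ 0 := by
        intro h; apply hD; field_simp; rw [h, mul_zero]
      field_simp
      ring
    have h2 : (modGen n .F) ((qInt a * qInt (n + 2 * b - a + 1)) • bv (a - 1) b) =
        (qInt a * qInt (n + 2 * b - a + 1)) • bv a b := by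
      rcases a with _ | a
      · simp [qInt_zero]
      · rw [map_smul, modGen_F, Nat.add_sub_cancel]
    simp only [Module.End.mul_apply, LinearMap.smul_apply, LinearMap.sub_apply, modGen_F, modGen_K,
      modGen_Kinv]
    rw [modGen_E, modGen_E, map_add, h2, modGen_F, ← sub_smul, smul_smul, ← key, sub_smul]
    push_cast
    abel
  idem_idem m m' := end_ext fun a b => by
    simp only [Module.End.mul_apply, modGen_idem]
    by_cases h1 : n + 2 * (b : ℤ) - 2 * a = m'
    · rw [if_pos h1, modGen_idem]
      by_cases h2 : m = m'
      · rw [if_pos h2, modGen_idem, h2]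
      · rw [if_neg h2, if_neg (fun h => h2 (h.symm.trans h1))]
        simp
    · rw [if_neg h1, map_zero]
      by_cases h2 : m = m'
      · rw [if_pos h2, modGen_idem, if_neg (fun h => h1 (h.trans h2))]
      · rw [if_neg h2]
        simp
  K_idem m := end_ext fun a b => by
    simp only [Module.End.mul_apply, LinearMap.smul_apply, modGen_idem]
    split_ifs with h
    · rw [modGen_K, h]
    · simp
  idem_K m := end_ext fun a b => by
    simp only [Module.End.mul_apply, LinearMap.smul_apply, modGen_idem, modGen_K, map_smul]
    split_ifs with h
    · rw [h]
    · simp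
  E_idem m := end_ext fun a b => by
    rcases a with _ | a
    · simp only [Module.End.mul_apply, modGen_idem, modGen_E]
      simp only [Nat.cast_zero, qInt_zero, zero_mul, zero_smul, add_zero, modGen_idem]
      split_ifs with h1 h2 h2
      · rw [modGen_E]; simp [qInt_zero]
      · exact absurd (by push_cast at *; omega) h2
      · exact absurd (by push_cast at *; omega) h1
      · simp
    · simp only [Module.End.mul_apply, modGen_idem, modGen_E, map_add, map_smul,
        Nat.add_sub_cancel]
      by_cases h1 : n + 2 * (b : ℤ) - 2 * ((a + 1 : ℕ) : ℤ) = m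
      · rw [if_pos h1, if_pos (by push_cast at *; omega), if_pos (by push_cast at *; omega),
          modGen_E, Nat.add_sub_cancel]
      · rw [if_neg h1, if_neg (by push_cast at *; omega), if_neg (by push_cast at *; omega)]
        simp
  F_idem m := end_ext fun a b => by
    simp only [Module.End.mul_apply, modGen_idem, modGen_F]
    split_ifs with h1 h2 h2
    · rw [modGen_F]
    · exact absurd (by push_cast at *; omega) h2
    · exact absurd (by push_cast at *; omega) h1
    · simp

/-- The action of `UI`. -/
def modHom (n : ℤ) : UI →ₐ[Qq] Module.End Qq (ℕ × ℕ →₀ Qq) := liftHom (modGen n) (isRep_mod n)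

theorem modHom_gen (n : ℤ) (x : Gen) : modHom n (gen x) = modGen n x := liftHom_gen _ _ x

/-- The pairing of `1_n` with the basis vectors. -/
def modFun (n : ℤ) : (ℕ × ℕ →₀ Qq) →ₗ[Qq] Qq := Finsupp.linearCombination Qq fun p =>
  if p.1 = p.2 then
    qFactorial p.1 * q ^ (-n * p.1 - (p.1.choose 2 : ℕ) : ℤ) / (q - q⁻¹) ^ p.1 else 0

theorem modFun_bv (n : ℤ) (a b : ℕ) : modFun n (bv a b) = if a = b then
    qFactorial a * q ^ (-n * a - (a.choose 2 : ℕ) : ℤ) / (q - q⁻¹) ^ a else 0 := by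
  simp only [modFun, bv, Finsupp.linearCombination_single, one_smul]

/-- The pairing of `1_n` with `u 1_n`. -/
def modL (n : ℤ) : UI →ₗ[Qq] Qq where
  toFun u := modFun n (modHom n u (bv 0 0))
  map_add' u v := by simp
  map_smul' c u := by simp

theorem modL_one_left (n m : ℤ) (u : UI) :
    modL n (one m * u) = if m = n then modL n u else 0 := by
  have h : modFun n ∘ₗ modGen n (.idem m) = if m = n then modFun n else 0 := end_ext fun a b => by
    rw [LinearMap.comp_apply, modGen_idem]
    by_cases hm : m = n
    · rw [if_pos hm]
      split_ifs with h
      · rfl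
      · rw [modFun_bv, if_neg (by omega), map_zero]
    · rw [if_neg hm]
      split_ifs with h
      · rw [modFun_bv, if_neg (by omega), LinearMap.zero_apply]
      · simp
  have h2 : modL n (one m * u) = (modFun n ∘ₗ modGen n (.idem m)) (modHom n u (bv 0 0)) := by
    rw [← modHom_gen]
    simp [modL, one]
  rw [h2, h]
  split_ifs <;> rfl

theorem modL_one_right (n m : ℤ) (u : UI) :
    modL n (u * one m) = if m = n then modL n u else 0 := by
  have h2 : modL n (u * one m) = modFun n (modHom n u (modGen n (.idem m) (bv 0 0))) := by
    rw [← modHom_gen]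
    simp [modL, one]
  rw [h2, modGen_idem]
  by_cases hm : m = n
  · rw [if_pos (by simp [hm]), if_pos hm]; rfl
  · rw [if_neg (by simpa using Ne.symm hm), if_neg hm]; simp

theorem qFactorial_succ (a : ℕ) : qFactorial (a + 1) = qFactorial a * qInt (a + 1) := by
  rw [qFactorial, Finset.prod_Icc_succ_top (by omega), qFactorial]
  push_cast
  rfl

theorem modFun_E_pow (n : ℤ) (a c : ℕ) :
    modFun n (((modGen n .E) ^ a) (bv (a + c) c)) = qFactorial (a + c) *
      q ^ ((n + c) * a - n * c - (a.choose 2 : ℕ) - (c.choose 2 : ℕ) : ℤ) /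
        (q - q⁻¹) ^ (a + c) := by
  have hq := q_ne_zero
  have hD := q_sub_ne_zero
  induction a generalizing c with
  | zero =>
    rw [pow_zero, Module.End.one_apply, zero_add, modFun_bv, if_pos rfl]
    congr 3
    simp
  | succ a ih =>
    rw [pow_succ, Module.End.mul_apply, modGen_E, map_add, map_add, map_smul, map_smul]
    have e1 : bv (a + 1 + c) (c + 1) = bv (a + (c + 1)) (c + 1) := by congr 1; omega
    have e2 : a + 1 + c - 1 = a + c := by omega
    have e3 : a + 1 + c = a + c + 1 := by omega
    rw [e1, e2, ih, ih, e3, ← add_assoc a c 1, qFactorial_succ, smul_eq_mul, pow_succ]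
    have c2 : ((c + 1).choose 2 : ℤ) = c + (c.choose 2 : ℕ) := by
      rw [Nat.choose_succ_succ' c 1]; simp
    have a2 : ((a + 1).choose 2 : ℤ) = a + (a.choose 2 : ℕ) := by
      rw [Nat.choose_succ_succ' a 1]; simp
    rw [c2, a2]
    set t : ℤ := (n + c) * a - n * c - (a.choose 2 : ℕ) - (c.choose 2 : ℕ)
    have x1 : (n + ((c + 1 : ℕ) : ℤ)) * a - n * ((c + 1 : ℕ) : ℤ) - (a.choose 2 : ℕ) -
        (c + (c.choose 2 : ℕ)) = t - (n + c - a) := by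
      simp only [t]; push_cast; ring
    have x2 : (n + c) * ((a + 1 : ℕ) : ℤ) - n * c - (a + (a.choose 2 : ℕ)) - (c.choose 2 : ℕ) =
        t + (n + c - a) := by
      simp only [t]; push_cast; ring
    have x3 : n + 2 * (c : ℤ) - ((a + c + 1 : ℕ) : ℤ) + 1 = n + c - a := by push_cast; ring
    have x4 : (((a + c : ℕ) : ℤ) + 1) = ((a + c + 1 : ℕ) : ℤ) := by push_cast; ring
    rw [x1, x2, x3, x4]
    have x5 : qInt (n + c - a) * (q - q⁻¹) = q ^ (n + c - a) - q ^ (-(n + c - a)) := by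
      rw [qInt, div_mul_cancel₀ _ hD]
    rw [sub_eq_add_neg t, zpow_add₀ hq, zpow_add₀ hq]
    have x6 : q ^ (n + c - a) = qInt (n + c - a) * (q - q⁻¹) + q ^ (-(n + c - a)) := by
      rw [x5]; ring
    rw [x6]
    generalize q ^ (-(n + c - a)) = Y
    generalize qInt (n + c - a) = Z
    generalize q - q⁻¹ = D at *
    field_simp
    ring

theorem qInt_ne_zero (a : ℕ) : qInt (a + 1) ≠ 0 := by
  have hq := q_ne_zero
  rw [qInt]
  refine div_ne_zero ?_ q_sub_ne_zero
  intro h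
  apply q_zpow_ne_one (k := 2 * (a + 1)) (by omega)
  have h1 : q ^ ((a : ℤ) + 1) = q ^ (a + 1) := by norm_cast
  rw [zpow_neg, h1, sub_eq_zero] at h
  rw [two_mul, pow_add]
  nth_rewrite 1 [h]
  exact inv_mul_cancel₀ (pow_ne_zero _ hq)

theorem qFactorial_ne_zero (a : ℕ) : qFactorial a ≠ 0 := by
  induction a with
  | zero => simp [qFactorial]
  | succ a ih => rw [qFactorial_succ]; exact mul_ne_zero ih (qInt_ne_zero a)

theorem norm_eq (a : ℕ) : (qFactorial a)⁻¹ * q ^ ((a : ℤ) ^ 2 - (a.choose 2 : ℕ)) / (q - q⁻¹) ^ a =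
    ∏ s ∈ Finset.Icc 1 a, 1 / (1 - q ^ (-2 * (s : ℤ))) := by
  have hq := q_ne_zero
  have hD := q_sub_ne_zero
  induction a with
  | zero => simp [qFactorial]
  | succ a ih =>
    rw [Finset.prod_Icc_succ_top (by omega), ← ih, qFactorial_succ]
    have a2 : ((a + 1).choose 2 : ℤ) = a + (a.choose 2 : ℕ) := by
      rw [Nat.choose_succ_succ' a 1]; simp
    have x1 : (((a + 1 : ℕ) : ℤ)) ^ 2 - ((a + 1).choose 2 : ℕ) =
        ((a : ℤ) ^ 2 - (a.choose 2 : ℕ)) + (a + 1) := by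
      rw [a2]; push_cast; ring
    have x2 : (-2 * ((a + 1 : ℕ) : ℤ)) = -((a : ℤ) + 1) + -((a : ℤ) + 1) := by push_cast; ring
    have hz := qInt_ne_zero a
    have hf := qFactorial_ne_zero a
    have x3 : q ^ ((a : ℤ) + 1) - q ^ (-((a : ℤ) + 1)) = qInt (a + 1) * (q - q⁻¹) := by
      rw [qInt, div_mul_cancel₀ _ hD]
    have hT : q ^ ((a : ℤ) + 1) ≠ 0 := zpow_ne_zero _ hq
    rw [x1, x2, zpow_add₀ hq _ ((a : ℤ) + 1), zpow_add₀ hq (-((a : ℤ) + 1))]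
    have x4 : 1 - q ^ (-((a : ℤ) + 1)) * q ^ (-((a : ℤ) + 1)) =
        q ^ (-((a : ℤ) + 1)) * (qInt (a + 1) * (q - q⁻¹)) := by
      rw [← x3, mul_sub, ← zpow_add₀ hq, ← zpow_add₀ hq, neg_add_cancel, zpow_zero]
    rw [x4, zpow_neg, pow_succ (q - q⁻¹)]
    generalize q - q⁻¹ = D at *
    field_simp
    try rw [pow_succ]

theorem modL_FE (n : ℤ) (a : ℕ) : modL n (F ^ a * E ^ a) =
    qFactorial a * q ^ (-n * a - (a.choose 2 : ℕ) : ℤ) / (q - q⁻¹) ^ a := by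
  have hE : ∀ b : ℕ, (modGen n .E ^ b) (bv 0 0) = bv 0 b := by
    intro b
    induction b with
    | zero => simp
    | succ b ih =>
      rw [pow_succ', Module.End.mul_apply, ih, modGen_E]
      simp [qInt_zero]
  have hF : ∀ c : ℕ, (modGen n .F ^ c) (bv 0 a) = bv c a := by
    intro c
    induction c with
    | zero => simp
    | succ b ih => rw [pow_succ', Module.End.mul_apply, ih, modGen_F]
  have h : modL n (F ^ a * E ^ a) =
      modFun n ((modGen n .F ^ a) ((modGen n .E ^ a) (bv 0 0))) := by
    rw [← modHom_gen, ← modHom_gen]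
    simp [modL, E, F]
  rw [h, hE, hF, modFun_bv, if_pos rfl]

theorem modL_EF (n : ℤ) (a : ℕ) : modL n (E ^ a * F ^ a) =
    qFactorial a * q ^ (n * a - (a.choose 2 : ℕ) : ℤ) / (q - q⁻¹) ^ a := by
  have hF : ∀ c : ℕ, (modGen n .F ^ c) (bv 0 0) = bv c 0 := by
    intro c
    induction c with
    | zero => simp
    | succ b ih => rw [pow_succ', Module.End.mul_apply, ih, modGen_F]
  have h : modL n (E ^ a * F ^ a) =
      modFun n ((modGen n .E ^ a) ((modGen n .F ^ a) (bv 0 0))) := by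
    rw [← modHom_gen, ← modHom_gen]
    simp [modL, E, F]
  have h2 := modFun_E_pow n a 0
  rw [h, hF]
  simpa using h2

theorem rho_E_pow_mul_one (a : ℕ) (m : ℤ) :
    (q • (K * F)) ^ a * one m = q ^ (a * m - (a : ℤ) ^ 2) • (F ^ a * one m) := by
  have hq := q_ne_zero
  induction a with
  | zero => simp
  | succ a ih =>
    have h : K * (F * (F ^ a * one m)) = q ^ (m - 2 * (a + 1 : ℕ)) • (F ^ (a + 1) * one m) := by
      rw [← mul_assoc F, ← pow_succ', F_pow_mul_one, ← mul_assoc, K_mul_one, smul_mul_assoc]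
    rw [pow_succ', mul_assoc, ih, mul_smul_comm, smul_mul_assoc, mul_assoc K, h, smul_smul,
      smul_smul]
    congr 1
    nth_rewrite 2 [← zpow_one q]
    rw [← zpow_add₀ hq, ← zpow_add₀ hq]
    congr 1
    push_cast; ring

theorem rho_F_pow_mul_one (a : ℕ) (m : ℤ) :
    (q • (Kinv * E)) ^ a * one m = q ^ (-(a * m) - (a : ℤ) ^ 2) • (E ^ a * one m) := by
  have hq := q_ne_zero
  induction a with
  | zero => simp
  | succ a ih =>
    have h : Kinv * (E * (E ^ a * one m)) =
        q ^ (-(m + 2 * (a + 1 : ℕ))) • (E ^ (a + 1) * one m) := by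
      rw [← mul_assoc E, ← pow_succ', E_pow_mul_one, ← mul_assoc, Kinv_mul_one, smul_mul_assoc]
    rw [pow_succ', mul_assoc, ih, mul_smul_comm, smul_mul_assoc, mul_assoc Kinv, h, smul_smul,
      smul_smul]
    congr 1
    nth_rewrite 2 [← zpow_one q]
    rw [← zpow_add₀ hq, ← zpow_add₀ hq]
    congr 1
    push_cast; ring

theorem finite_weights (y : UI) (hy : y ∈ Udot) : {k : ℤ | y * one k ≠ 0}.Finite := by
  rw [Udot] at hy
  induction hy using Submodule.span_induction with
  | mem y hy =>
    obtain ⟨m, rfl⟩ := hy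
    refine (Set.finite_singleton m).subset fun k hk => ?_
    by_contra h
    exact hk (by rw [one_mul_one, if_neg (fun h' => h h'.symm)])
  | zero => simp
  | add y z _ _ hy hz =>
    refine (hy.union hz).subset fun k hk => ?_
    by_contra h
    rw [Set.mem_union, not_or, Set.mem_ofPred_eq, Set.mem_ofPred_eq, not_not, not_not] at h
    exact hk (by rw [add_mul, h.1, h.2, add_zero])
  | smul r y _ hy =>
    refine hy.subset fun k hk => ?_
    intro h
    exact hk (by rw [smul_eq_mul, mul_assoc, h, mul_zero])

theorem finite_support (u y : UI) (hy : y ∈ Udot) :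
    (Function.support fun k : ℤ => modL k (u * y)).Finite := by
  refine (finite_weights y hy).subset fun k hk => ?_
  intro h
  apply hk
  have := modL_one_right k k (u * y)
  rw [if_pos rfl] at this
  change modL k (u * y) = 0
  rw [← this, mul_assoc, h, mul_zero, map_zero]

/-- The bilinear form, as a sum over all weights. -/
def explicitForm : Udot →ₗ[Qq] Udot →ₗ[Qq] Qq :=
  LinearMap.mk₂ Qq (fun x y => ∑ᶠ k : ℤ, modL k (rho x * y))
    (fun x x' y => by
      rw [← finsum_add_distrib (finite_support _ _ y.2) (finite_support _ _ y.2)]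
      congr 1
      funext k
      rw [← map_add, ← add_mul, ← rho_add]
      rfl)
    (fun c x y => by
      rw [smul_finsum]
      congr 1
      funext k
      rw [← map_smul, ← smul_mul_assoc, ← rho_smul]
      rfl)
    (fun x y y' => by
      rw [← finsum_add_distrib (finite_support _ _ y.2) (finite_support _ _ y'.2)]
      congr 1
      funext k
      rw [← map_add, ← mul_add]
      rfl)
    (fun c x y => by
      rw [smul_finsum]
      congr 1
      funext k
      rw [← map_smul, ← mul_smul_comm]
      rfl)

theorem explicitForm_apply (x y : Udot) :
    explicitForm x y = ∑ᶠ k : ℤ, modL k (rho x * y) := rfl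

theorem explicitForm_orthogonal (n m n' m' : ℤ) (x y : Udot) (hx : one n * (x : UI) * one m = x)
    (hy : one n' * (y : UI) * one m' = y) (h : ¬ (n = n' ∧ m = m')) : explicitForm x y = 0 := by
  rw [explicitForm_apply]
  refine finsum_eq_zero_of_forall_eq_zero fun k => ?_
  rw [← hx, ← hy, rho_mul, rho_mul, rho_one, rho_one]
  by_cases hn : n = n'
  · have e : one m * (rho x * one n) * (one n' * (y : UI) * one m') =
        one m * (rho x * one n * one n' * y * one m') := by simp only [mul_assoc]
    rw [e, modL_one_left, modL_one_right]
    split_ifs with h1 h2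
    · exact absurd ⟨hn, h1.trans h2.symm⟩ h
    · rfl
    · rfl
  · have e : one m * (rho x * one n) * (one n' * (y : UI) * one m') =
        one m * rho x * (one n * one n') * y * one m' := by simp only [mul_assoc]
    rw [e, one_mul_one, if_neg hn]
    simp

theorem explicitForm_adjoint (u : UI) (x y : Udot) :
    explicitForm (u • x) y = explicitForm x (rho u • y) := by
  rw [explicitForm_apply, explicitForm_apply]
  congr 1
  funext k
  change modL k (rho (u * x) * y) = modL k (rho x * (rho u * y))
  rw [rho_mul, mul_assoc]

theorem explicitForm_atWeight (u v : UI) (n : ℤ) :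
    explicitForm (atWeight u n) (atWeight v n) = modL n (rho u * (v * one n)) := by
  rw [explicitForm_apply, finsum_eq_single _ n]
  · change modL n (rho (u * one n) * (v * one n)) = _
    rw [rho_mul, rho_one, mul_assoc, modL_one_left, if_pos rfl]
  · intro k hk
    change modL k (rho (u * one n) * (v * one n)) = _
    rw [← mul_assoc, modL_one_right, if_neg (Ne.symm hk)]

theorem explicitForm_E (a : ℕ) (n : ℤ) :
    explicitForm (atWeight (Ediv a) n) (atWeight (Ediv a) n) =
      ∏ s ∈ Finset.Icc 1 a, 1 / (1 - q ^ (-2 * (s : ℤ))) := by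
  have hq := q_ne_zero
  have hf := qFactorial_ne_zero a
  rw [explicitForm_atWeight, Ediv, rho_smul, rho_pow, rho_E, smul_mul_assoc, smul_mul_assoc,
    mul_smul_comm, E_pow_mul_one, ← mul_assoc, rho_E_pow_mul_one, smul_mul_assoc, mul_assoc,
    ← E_pow_mul_one, ← mul_assoc, map_smul, map_smul, map_smul, modL_one_right, if_pos rfl,
    modL_FE, ← norm_eq]
  have e : q ^ ((a : ℤ) ^ 2 - (a.choose 2 : ℕ)) = q ^ ((a : ℤ) * (n + 2 * a) - (a : ℤ) ^ 2) *
      q ^ (-n * a - (a.choose 2 : ℕ) : ℤ) := by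
    rw [← zpow_add₀ hq]; congr 1; ring
  rw [e]
  simp only [smul_eq_mul]
  field_simp

theorem explicitForm_F (a : ℕ) (n : ℤ) :
    explicitForm (atWeight (Fdiv a) n) (atWeight (Fdiv a) n) =
      ∏ s ∈ Finset.Icc 1 a, 1 / (1 - q ^ (-2 * (s : ℤ))) := by
  have hq := q_ne_zero
  have hf := qFactorial_ne_zero a
  rw [explicitForm_atWeight, Fdiv, rho_smul, rho_pow, rho_F, smul_mul_assoc, smul_mul_assoc,
    mul_smul_comm, F_pow_mul_one, ← mul_assoc, rho_F_pow_mul_one, smul_mul_assoc, mul_assoc,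
    ← F_pow_mul_one, ← mul_assoc, map_smul, map_smul, map_smul, modL_one_right, if_pos rfl,
    modL_EF, ← norm_eq]
  have e : q ^ ((a : ℤ) ^ 2 - (a.choose 2 : ℕ)) = q ^ (-((a : ℤ) * (n - 2 * a)) - (a : ℤ) ^ 2) *
      q ^ (n * a - (a.choose 2 : ℕ) : ℤ) := by
    rw [← zpow_add₀ hq]; congr 1; ring
  rw [e]
  simp only [smul_eq_mul]
  field_simp

theorem explicitForm_symm (x y : Udot) : explicitForm x y = explicitForm y x := by
  have h : explicitForm - explicitForm.flip = 0 := by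
    refine form_eq_zero _ ?_ ?_ ?_
    · intro n m n' m' x y hx hy h
      rw [LinearMap.sub_apply, LinearMap.sub_apply, LinearMap.flip_apply,
        explicitForm_orthogonal n m n' m' x y hx hy h,
        explicitForm_orthogonal n' m' n m y x hy hx (fun h' => h ⟨h'.1.symm, h'.2.symm⟩), sub_zero]
    · intro u x y
      rw [LinearMap.sub_apply, LinearMap.sub_apply, LinearMap.sub_apply, LinearMap.sub_apply,
        LinearMap.flip_apply, LinearMap.flip_apply, explicitForm_adjoint, explicitForm_adjoint,
        rho_rho]
    · intro a n
      rw [LinearMap.sub_apply, LinearMap.sub_apply, LinearMap.flip_apply, sub_self]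
  have h2 := congrArg (fun B => B x y) h
  exact sub_eq_zero.mp h2

/-- There is exactly one bilinear form on `U̇` with the properties in `IsLusztigForm`. -/
theorem existsUnique_lusztigForm : ∃! B, IsLusztigForm B := by
  refine ⟨explicitForm, ⟨explicitForm_orthogonal, explicitForm_adjoint, explicitForm_E,
    explicitForm_F, explicitForm_symm⟩, fun B hB => ?_⟩
  rw [← sub_eq_zero]
  refine form_eq_zero _ ?_ ?_ ?_
  · intro n m n' m' x y hx hy h
    rw [LinearMap.sub_apply, LinearMap.sub_apply, hB.orthogonal n m n' m' x y hx hy h,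
      explicitForm_orthogonal n m n' m' x y hx hy h, sub_zero]
  · intro u x y
    rw [LinearMap.sub_apply, LinearMap.sub_apply, LinearMap.sub_apply, LinearMap.sub_apply,
      hB.adjoint, explicitForm_adjoint]
  · intro a n
    have e : atWeight (E ^ a) n = qFactorial a • atWeight (Ediv a) n := by
      apply Subtype.ext
      change E ^ a * one n = qFactorial a • (Ediv a * one n)
      rw [Ediv, smul_mul_assoc, smul_smul, mul_inv_cancel₀ (qFactorial_ne_zero a), one_smul]
    rw [e, map_smul, map_smul, LinearMap.smul_apply, LinearMap.sub_apply, LinearMap.sub_apply,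
      hB.norm_E, explicitForm_E, sub_self, smul_zero, smul_zero]

/-- Lusztig's bilinear form `(,)` on `U̇`. -/
def lusztigForm : Udot →ₗ[Qq] Udot →ₗ[Qq] Qq := existsUnique_lusztigForm.choose

theorem isLusztigForm_lusztigForm : IsLusztigForm lusztigForm :=
  existsUnique_lusztigForm.choose_spec.1

/-- The semilinear form `⟨x, y⟩`, the conjugate of `(x, ψ(y))`. -/
def semilinearForm (x y : Udot) : Qq := bar (lusztigForm x (psiDot y))

end QuantumSl2
end

open QuantumSl2

/-! By uniqueness the form is `explicitForm`, so `(u 1_n, v 1_n)` is `modL n (ρ(u) v 1_n)`. Since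
`ρ` exchanges `E` and `F` up to `q`, `K` and `K⁻¹`, the first pairing is, up to an explicit power of
`q` and four quantum factorials, the number `modL n (E^b F^a E^c F^d)`; `ψ` fixes divided powers,
and what remains is to apply `bar`.

This number obeys a recursion in `a`. Moving one `F` to the right through `E^c` gives the word with
`(a, d)` replaced by `(a - 1, d + 1)`, minus a multiple of the word with `(a, c)` replaced by `(a -
1, c - 1)` (`modL_EFEF_succ`). At `a = 0` the word is `E^(b + c) F^d`, whose value is `modL_EF`.
Recursion and initial values determine everything.

It remains to see that the claimed sum obeys the same recursion (`pairingSum_rec`). Write a summand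
in the variables `x = a - j`, `y = b - j`, `z = j`, `w = c - a + j`, so that `x + z = a`, `y + z =
b`, `x + w = c`, `y + w = d`. The quantum integers `[a + 1] = [(x + 1) + z]` and `[d + 1] = [(w + 1)
+ y]` each split into two pieces, and each piece lowers the argument of one `g`, because `[k] g(k)`
is a multiple of `g(k - 1)`. Two of the four resulting pieces combine into the term with `c - 1`;
the other two are values of one function at `j` and at `j - 1`, so they telescope in the sum over
`j`.

The second formula is the image of the first under the symmetry `E ↔ F`, `n ↔ -n`: the same
recursion and initial values appear with `-n`, so `eq_pairingSum_of_rec` serves both. -/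

namespace QuantumSl2
noncomputable section

/-! ### Quantum integers and the function `g` -/

/-- The function `g`, extended by zero to negative integers. -/
def gInt (k : ℤ) : Qq := if 0 ≤ k then g k.toNat else 0

theorem gInt_natCast (k : ℕ) : gInt k = g k := by simp [gInt]

theorem gInt_of_neg {k : ℤ} (hk : k < 0) : gInt k = 0 := if_neg (not_le.mpr hk)

theorem one_sub_q_pow_ne_zero (k : ℕ) : 1 - q ^ (2 * (k + 1)) ≠ 0 :=
  fun h => q_zpow_ne_one (k := 2 * (k + 1)) (by omega) (sub_eq_zero.mp h).symm

theorem g_succ (k : ℕ) : g (k + 1) = g k * (1 / (1 - q ^ (2 * (k + 1)))) := by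
  rw [g, Finset.prod_Icc_succ_top (by omega), g]

/-- The last factor `1 - q^(2k)` in the denominator of `g(k)` equals `-q^k (q - q⁻¹) [k]`. Extending
`g` by zero makes both sides vanish for `k ≤ 0`, so the recursion for the sums needs no boundary
cases. -/
theorem qInt_mul_gInt (k : ℤ) : qInt k * gInt k = -(q - q⁻¹)⁻¹ * q ^ (-k) * gInt (k - 1) := by
  have hq := q_ne_zero
  rcases lt_trichotomy k 0 with hk | rfl | hk
  · rw [gInt_of_neg hk, gInt_of_neg (by omega), mul_zero, mul_zero]
  · rw [qInt_zero, gInt_of_neg (k := 0 - 1) (by omega), zero_mul, mul_zero]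
  · obtain ⟨m, rfl⟩ : ∃ m : ℕ, k = m + 1 := ⟨(k - 1).toNat, by omega⟩
    have h1 : gInt ((m : ℤ) + 1) = g (m + 1) := by exact_mod_cast gInt_natCast (m + 1)
    have h2 : q ^ ((m : ℤ) + 1) = q ^ (m + 1) := by norm_cast
    rw [h1, add_sub_cancel_right, gInt_natCast, g_succ, qInt, zpow_neg, h2]
    have h3 := one_sub_q_pow_ne_zero m
    rw [pow_mul'] at h3 ⊢
    have hT : q ^ (m + 1) ≠ 0 := pow_ne_zero _ hq
    generalize q ^ (m + 1) = T at *
    have hD := q_sub_ne_zero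
    generalize q - q⁻¹ = D at *
    field_simp
    ring

/-- This splits a quantum integer so that each half can be absorbed by a different factor `g`
through `qInt_mul_gInt`. -/
theorem qInt_add (x y : ℤ) : qInt (x + y) = q ^ y * qInt x + q ^ (-x) * qInt y := by
  have hq := q_ne_zero
  have e (s t : ℤ) : q ^ (s + t) = q ^ s * q ^ t := zpow_add₀ hq s t
  simp only [qInt, neg_add, e]
  ring

theorem qInt_neg (x : ℤ) : qInt (-x) = -qInt x := by
  rw [qInt, qInt, neg_neg, ← neg_div, neg_sub]

theorem bar_qInt (x : ℤ) : bar (qInt x) = qInt x := by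
  rw [qInt, map_div₀, map_sub, map_sub, map_zpow₀, map_zpow₀, map_inv₀, bar_q, inv_inv, inv_zpow',
    inv_zpow', neg_neg, ← neg_sub q, ← neg_sub (q ^ x), neg_div_neg_eq]

theorem bar_qFactorial (a : ℕ) : bar (qFactorial a) = qFactorial a := by
  simp only [qFactorial, map_prod, bar_qInt]

theorem bar_q_zpow (k : ℤ) : bar (q ^ k) = q ^ (-k) := by
  rw [map_zpow₀, bar_q, inv_zpow']

/-! ### The sum on the right-hand side and its recursion -/

/-- The summand `q ^ (2 z ^ 2 - (x + z - y - w + n) (z + w)) g(x) g(y) g(z) g(w)`. -/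
def pairingTerm (n x y z w : ℤ) : Qq :=
  q ^ (2 * z ^ 2 - (x + z - y - w + n) * (z + w)) * (gInt x * gInt y * gInt z * gInt w)

/-- The sum of all `pairingTerm n x y z w` with `x + z = a`, `y + z = b`, `x + w = c`. -/
def pairingSum (n a b c : ℤ) : Qq := ∑ᶠ j : ℤ, pairingTerm n (a - j) (b - j) j (c - a + j)

theorem pairingTerm_eq_zero {n x y z w : ℤ} (h : x < 0 ∨ y < 0 ∨ z < 0 ∨ w < 0) :
    pairingTerm n x y z w = 0 := by
  rcases h with h | h | h | h <;> simp [pairingTerm, gInt_of_neg h]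

theorem finite_support_pairingTerm (n a b e : ℤ) :
    (Function.support fun j : ℤ => pairingTerm n (a - j) (b - j) j (e + j)).Finite := by
  refine (Set.finite_Icc 0 a).subset fun j hj => ?_
  by_contra h
  rw [Set.mem_Icc, not_and_or] at h
  exact hj (pairingTerm_eq_zero (by omega))

/-- The terms that cancel by telescoping in `pairingSum_rec`. -/
def pairingCarry (n x y z w : ℤ) : Qq :=
  (q - q⁻¹)⁻¹ * q ^ (2 * z ^ 2 - (x + z - y - 1 - w + n) * (z + w) +
    (x - y - 1) * (n + x - y - 1) - w - y - 1) * (gInt x * gInt y * gInt z * gInt w)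

theorem finite_support_pairingCarry (n a b e : ℤ) :
    (Function.support fun j : ℤ => pairingCarry n (a - j) (b - j) j (e + j)).Finite := by
  refine (Set.finite_Icc 0 a).subset fun j hj => ?_
  by_contra h
  rw [Set.mem_Icc, not_and_or] at h
  apply hj
  rcases h with h | h
  · simp [pairingCarry, gInt_of_neg (not_le.mp h)]
  · simp [pairingCarry, gInt_of_neg (show a - j < 0 by omega)]

/-- In the splitting of `[(x + 1) + z]`, the part `[x + 1]` lowers `g(x + 1)` to `g(x)` and gives
the main term; the part `[z]` lowers `g(z)` and gives the carry. -/
theorem qInt_add_mul_pairingTerm_left (n x y z w : ℤ) :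
    qInt (x + 1 + z) * q ^ ((x - y + 1) * (n + (x - y) + 1)) * pairingTerm n (x + 1) y z w =
      -(q - q⁻¹)⁻¹ * q ^ ((x - y + 1) * (n + (x - y) + 1) + z - x - 1 +
        (2 * z ^ 2 - (x + 1 + z - y - w + n) * (z + w))) * (gInt x * gInt y * gInt z * gInt w) -
      pairingCarry n (x + 1) y (z - 1) w := by
  have hq := q_ne_zero
  have h1 := qInt_mul_gInt (x + 1)
  have h2 := qInt_mul_gInt z
  rw [add_sub_cancel_right] at h1
  rw [qInt_add, pairingTerm, pairingCarry]
  rw [show (x - y + 1) * (n + (x - y) + 1) + z - x - 1 +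
      (2 * z ^ 2 - (x + 1 + z - y - w + n) * (z + w)) = z + (-(x + 1)) +
      (x - y + 1) * (n + (x - y) + 1) + (2 * z ^ 2 - (x + 1 + z - y - w + n) * (z + w)) by ring,
    show 2 * (z - 1) ^ 2 - (x + 1 + (z - 1) - y - 1 - w + n) * (z - 1 + w) +
      (x + 1 - y - 1) * (n + (x + 1) - y - 1) - w - y - 1 = -(x + 1) + (-z) +
      (x - y + 1) * (n + (x - y) + 1) + (2 * z ^ 2 - (x + 1 + z - y - w + n) * (z + w)) by ring]
  simp only [zpow_add₀ hq _ (2 * z ^ 2 - _), zpow_add₀ hq _ ((x - y + 1) * _), zpow_add₀ hq z,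
    zpow_add₀ hq (-(x + 1)) (-z)]
  generalize q ^ (2 * z ^ 2 - (x + 1 + z - y - w + n) * (z + w)) = A
  generalize q ^ ((x - y + 1) * (n + (x - y) + 1)) = B
  linear_combination q ^ z * A * B * gInt y * gInt z * gInt w * h1 +
    q ^ (-(x + 1)) * A * B * gInt (x + 1) * gInt y * gInt w * h2

/-- Here `[w + 1]` gives the main term and `[y]` the carry. The exponent in `pairingCarry` is chosen
so that this carry and that of `qInt_add_mul_pairingTerm_left` are values of the same function. -/
theorem qInt_add_mul_pairingTerm_right (n x y z w : ℤ) :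
    qInt (w + 1 + y) * q ^ ((x - y) * (n + (x - y))) * pairingTerm n x y z (w + 1) =
      -(q - q⁻¹)⁻¹ * q ^ ((x - y) * (n + (x - y)) + y - w - 1 +
        (2 * z ^ 2 - (x + z - y - (w + 1) + n) * (z + (w + 1)))) *
          (gInt x * gInt y * gInt z * gInt w) -
      pairingCarry n x (y - 1) z (w + 1) := by
  have hq := q_ne_zero
  have h1 := qInt_mul_gInt (w + 1)
  have h2 := qInt_mul_gInt y
  rw [add_sub_cancel_right] at h1
  rw [qInt_add, pairingTerm, pairingCarry]
  rw [show (x - y) * (n + (x - y)) + y - w - 1 +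
      (2 * z ^ 2 - (x + z - y - (w + 1) + n) * (z + (w + 1))) = y + (-(w + 1)) +
      (x - y) * (n + (x - y)) + (2 * z ^ 2 - (x + z - y - (w + 1) + n) * (z + (w + 1))) by ring,
    show 2 * z ^ 2 - (x + z - (y - 1) - 1 - (w + 1) + n) * (z + (w + 1)) +
      (x - (y - 1) - 1) * (n + x - (y - 1) - 1) - (w + 1) - (y - 1) - 1 = -(w + 1) + (-y) +
      (x - y) * (n + (x - y)) + (2 * z ^ 2 - (x + z - y - (w + 1) + n) * (z + (w + 1))) by ring]
  simp only [zpow_add₀ hq _ (2 * z ^ 2 - _), zpow_add₀ hq _ ((x - y) * _), zpow_add₀ hq y,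
    zpow_add₀ hq (-(w + 1)) (-y)]
  generalize q ^ (2 * z ^ 2 - (x + z - y - (w + 1) + n) * (z + (w + 1))) = A
  generalize q ^ ((x - y) * (n + (x - y))) = B
  linear_combination q ^ y * A * B * gInt y * gInt z * gInt x * h1 +
    q ^ (-(w + 1)) * A * B * gInt (w + 1) * gInt x * gInt z * h2

/-- Both main terms are multiples of `g(x) g(y) g(z) g(w)`. Apart from a common factor, their powers
of `q` have exponents `m` and `-m` with `m = n - 2 (y + w) + (x + w)`, so their difference is `(q -
q⁻¹) [m]`, and `q - q⁻¹` cancels. -/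
theorem pairingTerm_rec (n x y z w : ℤ) :
    qInt (x + 1 + z) * q ^ ((x - y + 1) * (n + (x - y) + 1)) * pairingTerm n (x + 1) y z w =
      qInt (w + 1 + y) * q ^ ((x - y) * (n + (x - y))) * pairingTerm n x y z (w + 1) -
      qInt (n - 2 * (y + w) + (x + w)) * q ^ ((x - y) * (n + (x - y))) * pairingTerm n x y z w +
      (pairingCarry n x (y - 1) z (w + 1) - pairingCarry n (x + 1) y (z - 1) w) := by
  have hq := q_ne_zero
  rw [qInt_add_mul_pairingTerm_left, qInt_add_mul_pairingTerm_right, pairingTerm, qInt]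
  rw [show (x - y + 1) * (n + (x - y) + 1) + z - x - 1 +
      (2 * z ^ 2 - (x + 1 + z - y - w + n) * (z + w)) = (n - 2 * (y + w) + (x + w)) +
      (x - y) * (n + (x - y)) + (2 * z ^ 2 - (x + z - y - w + n) * (z + w)) by ring,
    show (x - y) * (n + (x - y)) + y - w - 1 +
      (2 * z ^ 2 - (x + z - y - (w + 1) + n) * (z + (w + 1))) = -(n - 2 * (y + w) + (x + w)) +
      (x - y) * (n + (x - y)) + (2 * z ^ 2 - (x + z - y - w + n) * (z + w)) by ring]
  simp only [zpow_add₀ hq _ (2 * z ^ 2 - _), zpow_add₀ hq _ ((x - y) * _)]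
  ring

/-- Sum `pairingTerm_rec` over `j`: the two families of carries differ by the shift `j ↦ j - 1` and
cancel. All sums are finite, which justifies separating them. -/
theorem pairingSum_rec (n a b c d : ℤ) (h : a + 1 + d = b + c) :
    qInt (a + 1) * q ^ ((a - b + 1) * (n + (a - b) + 1)) * pairingSum n (a + 1) b c =
      qInt (d + 1) * q ^ ((a - b) * (n + (a - b))) * pairingSum n a b c -
      qInt (n - 2 * d + c - 1) * q ^ ((a - b) * (n + (a - b))) * pairingSum n a b (c - 1) := by
  have f1 := finite_support_pairingTerm n (a + 1) b (c - (a + 1))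
  have f2 := finite_support_pairingTerm n a b (c - a)
  have f3 := finite_support_pairingTerm n a b (c - 1 - a)
  have f4 := finite_support_pairingCarry n a (b - 1) (c - a)
  have f5 : (Function.support fun j : ℤ =>
      pairingCarry n (a - (j - 1)) (b - 1 - (j - 1)) (j - 1) (c - a + (j - 1))).Finite :=
    f4.preimage (f := fun j : ℤ => j - 1) (sub_left_injective.injOn)
  have h5 : ∑ᶠ j : ℤ,
      pairingCarry n (a - (j - 1)) (b - 1 - (j - 1)) (j - 1) (c - a + (j - 1)) =
      ∑ᶠ j : ℤ, pairingCarry n (a - j) (b - 1 - j) j (c - a + j) :=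
    finsum_comp_equiv (Equiv.subRight (1 : ℤ))
      (f := fun j => pairingCarry n (a - j) (b - 1 - j) j (c - a + j))
  have key : ∀ j : ℤ,
      qInt (a + 1) * q ^ ((a - b + 1) * (n + (a - b) + 1)) *
        pairingTerm n (a + 1 - j) (b - j) j (c - (a + 1) + j) +
      qInt (n - 2 * d + c - 1) * q ^ ((a - b) * (n + (a - b))) *
        pairingTerm n (a - j) (b - j) j (c - 1 - a + j) +
      pairingCarry n (a - (j - 1)) (b - 1 - (j - 1)) (j - 1) (c - a + (j - 1)) =
      qInt (d + 1) * q ^ ((a - b) * (n + (a - b))) *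
        pairingTerm n (a - j) (b - j) j (c - a + j) +
      pairingCarry n (a - j) (b - 1 - j) j (c - a + j) := by
    intro j
    -- The last variable is that of the term with `c - 1`; then `x + w = c - 1` and `y + w = d`.
    have := pairingTerm_rec n (a - j) (b - j) j (c - 1 - a + j)
    obtain rfl : d = b + c - a - 1 := by omega
    ring_nf at this ⊢
    linear_combination this
  have hmul (r : Qq) (f : ℤ → Qq) : ∑ᶠ j, r * f j = r * ∑ᶠ j, f j := (smul_finsum r f).symm
  have hsupp (r : Qq) (f : ℤ → Qq) : (Function.support fun j => r * f j) ⊆ Function.support f :=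
    fun j hj hf => hj (by simp [hf])
  have sum := finsum_congr key
  rw [finsum_add_distrib ?_ f5, finsum_add_distrib ?_ ?_, finsum_add_distrib ?_ f4, h5,
    hmul, hmul, hmul] at sum
  · rw [pairingSum, pairingSum, pairingSum]
    linear_combination sum
  · exact f2.subset (hsupp _ _)
  · exact f1.subset (hsupp _ _)
  · exact f3.subset (hsupp _ _)
  · exact ((f1.subset (hsupp _ _)).union (f3.subset (hsupp _ _))).subset
      (Function.support_add _ _)

/-- The four arguments of `g` are nonnegative exactly on the stated range, where the natural
subtractions agree with the integer ones; outside it the term is zero. -/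
theorem pairingSum_eq_sum (n : ℤ) (a b c : ℕ) :
    pairingSum n a b c = ∑ j ∈ Finset.Icc (a - c) (min a b),
      q ^ (2 * (j : ℤ) ^ 2 + ((a : ℤ) - (b + c - a) + n) * ((a : ℤ) - c - 2 * j)) *
        g (a - j) * g (b - j) * g j * g (c + j - a) := by
  rw [pairingSum, finsum_eq_sum_of_support_subset
    (s := (Finset.Icc (a - c) (min a b)).map Nat.castEmbedding), Finset.sum_map]
  · refine Finset.sum_congr rfl fun j hj => ?_
    rw [Finset.mem_Icc, le_min_iff] at hj
    obtain ⟨h1, h2, h3⟩ := hj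
    rw [pairingTerm, Nat.castEmbedding_apply,
      show (a : ℤ) - j = ((a - j : ℕ) : ℤ) by omega, show (b : ℤ) - j = ((b - j : ℕ) : ℤ) by omega,
      show (c : ℤ) - a + j = ((c + j - a : ℕ) : ℤ) by omega]
    simp only [gInt_natCast, ← mul_assoc]
    congr 5
    rw [Nat.cast_sub h2, Nat.cast_sub h3, Nat.cast_sub (show a ≤ c + j by omega)]
    push_cast
    ring
  · intro j hj
    by_contra h
    refine hj (pairingTerm_eq_zero ?_)
    by_contra h2
    push Not at h2
    obtain ⟨h2, h3, h4, h5⟩ := h2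
    apply h
    rw [Finset.mem_coe, Finset.mem_map]
    exact ⟨j.toNat, Finset.mem_Icc.mpr ⟨by omega, le_min (by omega) (by omega)⟩, by simp [h4]⟩

/-! ### Initial values and solution of the recursion -/

theorem choose_two_succ (a : ℕ) : ((a + 1).choose 2 : ℤ) = a + (a.choose 2 : ℕ) := by
  rw [Nat.choose_succ_succ' a 1]; simp

theorem sq_eq_add_two_mul_choose_two (a : ℕ) : (a : ℤ) ^ 2 = a + 2 * (a.choose 2 : ℕ) := by
  induction a with
  | zero => simp
  | succ a ih =>
    rw [choose_two_succ]
    push_cast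
    linear_combination ih

theorem choose_two_add (a b : ℕ) :
    ((a + b).choose 2 : ℤ) = (a.choose 2 : ℕ) + (b.choose 2 : ℕ) + a * b := by
  induction b with
  | zero => simp
  | succ b ih =>
    rw [← add_assoc, choose_two_succ, choose_two_succ, ih]
    push_cast
    ring

/-- This is `norm_eq` after `bar`, which turns `1 - q^(-2s)` into `1 - q^(2s)`. It makes the sum at
`a = 0` comparable with the values of `modL` on `E^d F^d` and `F^d E^d`. -/
theorem g_eq (a : ℕ) :
    g a = (qFactorial a)⁻¹ * q ^ (-(a : ℤ) - (a.choose 2 : ℕ)) / (q⁻¹ - q) ^ a := by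
  have h := congrArg bar (norm_eq a)
  simp only [map_prod, map_div₀, map_mul, map_inv₀, map_pow, map_sub, map_one, bar_qFactorial,
    bar_q_zpow, bar_q, inv_inv] at h
  rw [g]
  refine (Finset.prod_congr rfl fun j _ => ?_).trans (h.symm.trans ?_)
  · congr 2
    rw [neg_mul, neg_neg]
    norm_cast
  · have := sq_eq_add_two_mul_choose_two a
    congr 3
    omega

theorem pairingSum_zero (n : ℤ) (b c : ℕ) : pairingSum n 0 b c =
    q ^ ((b + c - n) * c : ℤ) * (g b * g c) := by
  have h := pairingSum_eq_sum n 0 b c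
  have e : Finset.Icc (0 - c) (min 0 b) = {0} := by simp
  rw [e, Finset.sum_singleton] at h
  have g0 : g 0 = 1 := by simp [g]
  rw [Nat.cast_zero] at h
  rw [h]
  simp only [Nat.sub_zero, add_zero, g0, mul_one, mul_assoc]
  congr 2
  push_cast
  ring

/-- The recursion in `a` and its values at `a = 0` determine the pairing. -/
theorem eq_pairingSum_of_rec (n : ℤ) (N : ℕ → ℕ → ℕ → ℕ → Qq)
    (base : ∀ b c d : ℕ, d = b + c → N 0 b c d =
      qFactorial d * q ^ (-n * d + (d.choose 2 : ℕ) : ℤ) / (q⁻¹ - q) ^ d)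
    (step : ∀ a b c d : ℕ, N (a + 1) b c d = N a b c (d + 1) -
      qInt c * qInt (n - 2 * d + c - 1) * N a b (c - 1) d)
    (a b c d : ℕ) (h : a + d = b + c) :
    N a b c d = qFactorial a * qFactorial b * qFactorial c * qFactorial d *
      (q ^ (((a : ℤ) - b) * (n + (a - b))) * pairingSum n a b c) := by
  have hq := q_ne_zero
  induction a generalizing c d with
  | zero =>
    have hb := qFactorial_ne_zero b
    have hc := qFactorial_ne_zero c
    obtain rfl : d = b + c := by omega
    rw [base b c _ rfl, Nat.cast_zero, pairingSum_zero, g_eq, g_eq, choose_two_add, pow_add]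
    have e : q ^ (-n * (b + c : ℕ) + ((b.choose 2 : ℕ) + (c.choose 2 : ℕ) + b * c) : ℤ) =
        q ^ ((0 - (b : ℤ)) * (n + (0 - b))) * (q ^ ((b + c - n) * c : ℤ) *
          (q ^ (-(b : ℤ) - (b.choose 2 : ℕ)) * q ^ (-(c : ℤ) - (c.choose 2 : ℕ)))) := by
      rw [← zpow_add₀ hq, ← zpow_add₀ hq, ← zpow_add₀ hq]
      congr 1
      push_cast
      linear_combination -sq_eq_add_two_mul_choose_two b - sq_eq_add_two_mul_choose_two c
    have f0 : qFactorial 0 = 1 := by simp [qFactorial]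
    rw [e, f0]
    have hD : q⁻¹ - q ≠ 0 := by
      rw [← neg_sub]; exact neg_ne_zero.mpr q_sub_ne_zero
    generalize q⁻¹ - q = D at *
    field_simp
  | succ a ih =>
    have hr := pairingSum_rec n a b c d (by omega)
    have h1 := ih c (d + 1) (by omega)
    have h2 : qInt c * N a b (c - 1) d = qFactorial a * qFactorial b * qFactorial c *
        qFactorial d * (q ^ (((a : ℤ) - b) * (n + (a - b))) * pairingSum n a b (c - 1)) := by
      rcases c with _ | c
      -- For `c = 0` the natural number `c - 1` is truncated, but its coefficient `[0]` vanishes. On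
      -- the other side `c - 1` is the integer `-1`, and `x + w = -1` forces a negative argument of
      -- `g`.
      · have hz : pairingSum n a b ((0 : ℕ) - 1) = 0 :=
          finsum_eq_zero_of_forall_eq_zero fun j => pairingTerm_eq_zero (by omega)
        rw [hz]
        simp [qInt_zero]
      · rw [Nat.add_sub_cancel, ih c d (by omega), qFactorial_succ c]
        push_cast
        rw [add_sub_cancel_right]
        ring
    rw [step, h1, mul_right_comm (qInt c), h2, qFactorial_succ a, qFactorial_succ d]
    push_cast
    rw [show (a : ℤ) + 1 - b = a - b + 1 by ring, ← add_assoc n]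
    linear_combination -(qFactorial a * qFactorial b * qFactorial c * qFactorial d) * hr

/-! ### Commutation relations and the recursion for `modL` -/

theorem UI_sub_smul (s t : Qq) (u : UI) : (s - t) • u = s • u - t • u := by
  simp only [Algebra.smul_def, map_sub, sub_mul]

theorem UI_neg_smul (s : Qq) (u : UI) : (-s) • u = -(s • u) := by
  rw [← zero_sub, UI_sub_smul, zero_smul, zero_sub]

theorem K_sub_Kinv_mul_one (m : ℤ) : (q - q⁻¹)⁻¹ • ((K - Kinv) * one m) = qInt m • one m := by
  rw [sub_mul, K_mul_one, Kinv_mul_one, ← UI_sub_smul, smul_smul, qInt, div_eq_inv_mul]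

/-- The coefficient identity behind the inductive steps of `F_mul_E_pow_mul_one` and
`E_mul_F_pow_mul_one`. -/
theorem qInt_succ_mul (c m : ℤ) :
    qInt (c + 1) * qInt (m + c) = qInt c * qInt (m + c - 1) + qInt (m + 2 * c) := by
  have hq := q_ne_zero
  have hD := q_sub_ne_zero
  rw [show m + c - 1 = (m + c) - 1 by ring, show m + 2 * c = (m + c) + c by ring]
  generalize m + c = w
  simp only [qInt, zpow_neg, zpow_add₀ hq, zpow_sub₀ hq, zpow_one]
  have hA : q ^ c ≠ 0 := zpow_ne_zero _ hq
  have hW : q ^ w ≠ 0 := zpow_ne_zero _ hq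
  generalize q ^ c = A at *
  generalize q ^ w = W at *
  have hD' : q ^ 2 - 1 ≠ 0 := by
    intro h; apply hD; field_simp; rw [h, mul_zero]
  field_simp
  ring

/-- Each passage of `F` across one `E` costs a Cartan term; on `E^c 1_m`, of weight `m + 2c`, this
is the scalar `[m + 2c]`, and these scalars add up by `qInt_succ_mul`. -/
theorem F_mul_E_pow_mul_one (c : ℕ) (m : ℤ) : F * (E ^ c * one m) =
    E ^ c * (F * one m) - (qInt c * qInt (m + c - 1)) • (E ^ (c - 1) * one m) := by
  induction c with
  | zero => simp [qInt_zero]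
  | succ c ih =>
    have hFE : F * E = E * F - (q - q⁻¹)⁻¹ • (K - Kinv) := by rw [← E_F_comm]; abel
    have hE : E * ((qInt c * qInt (m + c - 1)) • (E ^ (c - 1) * one m)) =
        (qInt c * qInt (m + c - 1)) • (E ^ c * one m) := by
      -- For `c = 0` the exponent `c - 1` is truncated, but the coefficient contains `[0] = 0`.
      rcases c with _ | c
      · simp [qInt_zero]
      · rw [mul_smul_comm, Nat.add_sub_cancel, ← mul_assoc, ← pow_succ']
    rw [pow_succ', mul_assoc, ← mul_assoc, hFE, sub_mul, mul_assoc, ih, mul_sub, hE,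
      smul_mul_assoc, E_pow_mul_one, ← mul_assoc (K - Kinv), ← smul_mul_assoc _ (_ * one _), K_sub_Kinv_mul_one,
      smul_mul_assoc, ← E_pow_mul_one, sub_sub, ← add_smul, Nat.add_sub_cancel, ← mul_assoc E]
    congr 2
    rw [← qInt_succ_mul]
    push_cast
    ring_nf

/-- The mirror image of `F_mul_E_pow_mul_one` under `E ↔ F`, `m ↔ -m`; the Cartan term changes sign,
as does the quantum integer. -/
theorem E_mul_F_pow_mul_one (c : ℕ) (m : ℤ) : E * (F ^ c * one m) =
    F ^ c * (E * one m) - (qInt c * qInt (-m + c - 1)) • (F ^ (c - 1) * one m) := by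
  induction c with
  | zero => simp [qInt_zero]
  | succ c ih =>
    have hEF : E * F = F * E + (q - q⁻¹)⁻¹ • (K - Kinv) := by rw [← E_F_comm]; abel
    have hF : F * ((qInt c * qInt (-m + c - 1)) • (F ^ (c - 1) * one m)) =
        (qInt c * qInt (-m + c - 1)) • (F ^ c * one m) := by
      rcases c with _ | c
      · simp [qInt_zero]
      · rw [mul_smul_comm, Nat.add_sub_cancel, ← mul_assoc, ← pow_succ']
    have hm : qInt (m - 2 * c) = -qInt (-m + 2 * c) := by rw [← qInt_neg]; congr 1; ring
    rw [pow_succ', mul_assoc, ← mul_assoc, hEF, add_mul, mul_assoc, ih, mul_sub, hF,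
      smul_mul_assoc, F_pow_mul_one, ← mul_assoc (K - Kinv), ← smul_mul_assoc _ (_ * one _), K_sub_Kinv_mul_one,
      smul_mul_assoc, ← F_pow_mul_one, hm, UI_neg_smul, ← sub_eq_add_neg, sub_sub, ← add_smul,
      Nat.add_sub_cancel, ← mul_assoc F]
    congr 2
    rw [← qInt_succ_mul]
    push_cast
    ring_nf

/-- The last `F` of `F^(a + 1)` passes through `E^c`, which acts on `F^d 1_n`, of weight `n - 2d`.
The idempotent `1_n` may be inserted because `modL n` does not see it. -/
theorem modL_EFEF_succ (n : ℤ) (a b c d : ℕ) :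
    modL n (E ^ b * F ^ (a + 1) * E ^ c * F ^ d) = modL n (E ^ b * F ^ a * E ^ c * F ^ (d + 1)) -
      qInt c * qInt (n - 2 * d + c - 1) * modL n (E ^ b * F ^ a * E ^ (c - 1) * F ^ d) := by
  have hone (u : UI) : modL n u = modL n (u * one n) := by rw [modL_one_right, if_pos rfl]
  rw [hone, hone (_ * F ^ (d + 1)), hone (_ * _ * F ^ d), ← smul_eq_mul (_ * _ : Qq), ← map_smul, ← map_sub]
  congr 1
  have h := congrArg (fun u => E ^ b * F ^ a * u * F ^ d) (F_mul_E_pow_mul_one c (n - 2 * d))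
  simp only [mul_sub, sub_mul, mul_smul_comm, smul_mul_assoc, mul_assoc, ← F_pow_mul_one] at h
  simp only [mul_assoc, pow_succ]
  rw [h, ← mul_assoc F, ← pow_succ', pow_succ, mul_assoc]

theorem modL_FEFE_succ (n : ℤ) (a b c d : ℕ) :
    modL n (F ^ b * E ^ (a + 1) * F ^ c * E ^ d) = modL n (F ^ b * E ^ a * F ^ c * E ^ (d + 1)) -
      qInt c * qInt (-n - 2 * d + c - 1) * modL n (F ^ b * E ^ a * F ^ (c - 1) * E ^ d) := by
  have hone (u : UI) : modL n u = modL n (u * one n) := by rw [modL_one_right, if_pos rfl]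
  rw [hone, hone (_ * E ^ (d + 1)), hone (_ * _ * E ^ d), ← smul_eq_mul (_ * _ : Qq), ← map_smul, ← map_sub]
  congr 1
  have h := congrArg (fun u => F ^ b * E ^ a * u * E ^ d) (E_mul_F_pow_mul_one c (n + 2 * d))
  simp only [mul_sub, sub_mul, mul_smul_comm, smul_mul_assoc, mul_assoc, ← E_pow_mul_one] at h
  simp only [mul_assoc, pow_succ]
  rw [h, ← mul_assoc E, ← pow_succ', pow_succ, mul_assoc, neg_add']

/-- Quantum integers are fixed by `bar`, so the recursion survives it unchanged; only the initial
values are conjugated. -/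
theorem bar_modL_EFEF (n : ℤ) (a b c d : ℕ) (h : a + d = b + c) :
    bar (modL n (E ^ b * F ^ a * E ^ c * F ^ d)) =
      qFactorial a * qFactorial b * qFactorial c * qFactorial d *
        (q ^ (((a : ℤ) - b) * (n + (a - b))) * pairingSum n a b c) := by
  refine eq_pairingSum_of_rec n
    (fun a b c d => bar (modL n (E ^ b * F ^ a * E ^ c * F ^ d))) ?_ ?_ a b c d h
  · rintro b c d rfl
    rw [pow_zero, mul_one, ← pow_add, modL_EF]
    simp only [map_div₀, map_mul, map_pow, map_sub, map_inv₀, bar_qFactorial, bar_q_zpow, bar_q,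
      inv_inv]
    congr 3
    ring
  · intro a b c d
    simp only [modL_EFEF_succ n a b c d, map_sub, map_mul, bar_qInt]

theorem bar_modL_FEFE (n : ℤ) (a b c d : ℕ) (h : a + d = b + c) :
    bar (modL n (F ^ b * E ^ a * F ^ c * E ^ d)) =
      qFactorial a * qFactorial b * qFactorial c * qFactorial d *
        (q ^ (((a : ℤ) - b) * (-n + (a - b))) * pairingSum (-n) a b c) := by
  refine eq_pairingSum_of_rec (-n)
    (fun a b c d => bar (modL n (F ^ b * E ^ a * F ^ c * E ^ d))) ?_ ?_ a b c d h
  · rintro b c d rfl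
    rw [pow_zero, mul_one, ← pow_add, modL_FE]
    simp only [map_div₀, map_mul, map_pow, map_sub, map_inv₀, bar_qFactorial, bar_q_zpow, bar_q,
      inv_inv]
    congr 3
    ring
  · intro a b c d
    simp only [modL_FEFE_succ n a b c d, map_sub, map_mul, bar_qInt]

/-! ### The semilinear form on products of divided powers -/

theorem psi_E : psi E = E := psi_gen .E
theorem psi_F : psi F = F := psi_gen .F
theorem psi_one (n : ℤ) : psi (one n) = one n := psi_gen (.idem n)

theorem psi_Ediv (a : ℕ) : psi (Ediv a) = Ediv a := by
  rw [Ediv, psi_smul, map_pow, psi_E, map_inv₀, bar_qFactorial]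

theorem psi_Fdiv (a : ℕ) : psi (Fdiv a) = Fdiv a := by
  rw [Fdiv, psi_smul, map_pow, psi_F, map_inv₀, bar_qFactorial]

/-- Uniqueness replaces the abstract form by `explicitForm`, and `ψ` disappears on invariant
elements. -/
theorem semilinearForm_atWeight (u v : UI) (n : ℤ) (hv : psi v = v) :
    semilinearForm (atWeight u n) (atWeight v n) = bar (modL n (rho u * (v * one n))) := by
  have h : lusztigForm = explicitForm :=
    existsUnique_lusztigForm.unique isLusztigForm_lusztigForm
      ⟨explicitForm_orthogonal, explicitForm_adjoint, explicitForm_E, explicitForm_F,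
        explicitForm_symm⟩
  have hp : psiDot (atWeight v n) = atWeight v n := by
    apply Subtype.ext
    change psi (v * one n) = v * one n
    rw [map_mul, hv, psi_one]
  rw [semilinearForm, hp, h, explicitForm_atWeight]

/-- Applying `ρ` to `E^a` and to `F^b` yields one power of `q` each, read off from the weights of
the vectors they act on. After `bar`, and because `a - b = c - d`, these two cancel the factor
`q^((a - b)(n + a - b))` of `bar_modL_EFEF`; the factorials cancel against the divided powers. -/
theorem semilinearForm_EF (a b c d : ℕ) (n : ℤ) (h : a + d = b + c) :
    semilinearForm (atWeight (Ediv a * Fdiv b) n) (atWeight (Ediv c * Fdiv d) n) =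
      pairingSum n a b c := by
  have hq := q_ne_zero
  have h1 : (q • (K * F)) ^ a * (E ^ c * (F ^ d * one n)) =
      q ^ (a * (n - 2 * d + 2 * c) - (a : ℤ) ^ 2) • (F ^ a * (E ^ c * (F ^ d * one n))) := by
    rw [F_pow_mul_one, ← mul_assoc (E ^ c), E_pow_mul_one, ← mul_assoc, ← mul_assoc,
      rho_E_pow_mul_one, smul_mul_assoc, smul_mul_assoc]
    simp only [mul_assoc]
  have h2 : (q • (Kinv * E)) ^ b * (F ^ a * (E ^ c * (F ^ d * one n))) =
      q ^ (-(b * (n - 2 * d + 2 * c - 2 * a)) - (b : ℤ) ^ 2) •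
        (E ^ b * F ^ a * E ^ c * F ^ d * one n) := by
    -- The idempotent is moved to the left end, so that the weight on which `ρ(F)^b` acts becomes
    -- visible.
    have e : F ^ a * (E ^ c * (F ^ d * one n)) =
        one (n - 2 * d + 2 * c - 2 * a) * (F ^ a * E ^ c * F ^ d) := by
      rw [F_pow_mul_one, ← mul_assoc (E ^ c), E_pow_mul_one, ← mul_assoc, ← mul_assoc,
        F_pow_mul_one]
      simp only [mul_assoc]
    rw [e, ← mul_assoc, rho_F_pow_mul_one, smul_mul_assoc, mul_assoc (E ^ b), ← e]
    simp only [mul_assoc]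
  have hpsi : psi (Ediv c * Fdiv d) = Ediv c * Fdiv d := by rw [map_mul, psi_Ediv, psi_Fdiv]
  rw [semilinearForm_atWeight _ _ _ hpsi, rho_mul]
  simp only [Ediv, Fdiv, rho_smul, rho_pow, rho_E, rho_F, smul_mul_assoc, mul_smul_comm, mul_assoc,
    h1, h2]
  simp only [← mul_assoc (F ^ _), ← mul_assoc (E ^ _)]
  simp only [map_smul, smul_eq_mul, map_mul, map_inv₀, bar_qFactorial, bar_q_zpow, modL_one_right,
    if_true, bar_modL_EFEF n a b c d h]
  have e : q ^ (-(a * (n - 2 * d + 2 * c) - (a : ℤ) ^ 2)) *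
      (q ^ (-(-(b * (n - 2 * d + 2 * c - 2 * a)) - (b : ℤ) ^ 2)) *
        q ^ (((a : ℤ) - b) * (n + (a - b)))) = 1 := by
    obtain rfl : d = b + c - a := by omega
    rw [← zpow_add₀ hq, ← zpow_add₀ hq, Nat.cast_sub (by omega)]
    convert zpow_zero q using 2
    push_cast
    ring
  have ha := qFactorial_ne_zero a
  have hb := qFactorial_ne_zero b
  have hc := qFactorial_ne_zero c
  have hd := qFactorial_ne_zero d
  field_simp
  linear_combination pairingSum n a b c * e

/-- The mirror image of `semilinearForm_EF` under `E ↔ F`, `n ↔ -n`. -/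
theorem semilinearForm_FE (a b c d : ℕ) (n : ℤ) (h : a + d = b + c) :
    semilinearForm (atWeight (Fdiv a * Ediv b) n) (atWeight (Fdiv c * Ediv d) n) =
      pairingSum (-n) a b c := by
  have hq := q_ne_zero
  have h1 : (q • (Kinv * E)) ^ a * (F ^ c * (E ^ d * one n)) =
      q ^ (-(a * (n + 2 * d - 2 * c)) - (a : ℤ) ^ 2) • (E ^ a * (F ^ c * (E ^ d * one n))) := by
    rw [E_pow_mul_one, ← mul_assoc (F ^ c), F_pow_mul_one, ← mul_assoc, ← mul_assoc,
      rho_F_pow_mul_one, smul_mul_assoc, smul_mul_assoc]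
    simp only [mul_assoc]
  have h2 : (q • (K * F)) ^ b * (E ^ a * (F ^ c * (E ^ d * one n))) =
      q ^ (b * (n + 2 * d - 2 * c + 2 * a) - (b : ℤ) ^ 2) •
        (F ^ b * E ^ a * F ^ c * E ^ d * one n) := by
    have e : E ^ a * (F ^ c * (E ^ d * one n)) =
        one (n + 2 * d - 2 * c + 2 * a) * (E ^ a * F ^ c * E ^ d) := by
      rw [E_pow_mul_one, ← mul_assoc (F ^ c), F_pow_mul_one, ← mul_assoc, ← mul_assoc,
        E_pow_mul_one]
      simp only [mul_assoc]
    rw [e, ← mul_assoc, rho_E_pow_mul_one, smul_mul_assoc, mul_assoc (F ^ b), ← e]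
    simp only [mul_assoc]
  have hpsi : psi (Fdiv c * Ediv d) = Fdiv c * Ediv d := by rw [map_mul, psi_Ediv, psi_Fdiv]
  rw [semilinearForm_atWeight _ _ _ hpsi, rho_mul]
  simp only [Ediv, Fdiv, rho_smul, rho_pow, rho_E, rho_F, smul_mul_assoc, mul_smul_comm, mul_assoc,
    h1, h2]
  simp only [← mul_assoc (F ^ _), ← mul_assoc (E ^ _)]
  simp only [map_smul, smul_eq_mul, map_mul, map_inv₀, bar_qFactorial, bar_q_zpow, modL_one_right,
    if_true, bar_modL_FEFE n a b c d h]
  have e : q ^ (-(-(a * (n + 2 * d - 2 * c)) - (a : ℤ) ^ 2)) *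
      (q ^ (-(b * (n + 2 * d - 2 * c + 2 * a) - (b : ℤ) ^ 2)) *
        q ^ (((a : ℤ) - b) * (-n + (a - b)))) = 1 := by
    obtain rfl : d = b + c - a := by omega
    rw [← zpow_add₀ hq, ← zpow_add₀ hq, Nat.cast_sub (by omega)]
    convert zpow_zero q using 2
    push_cast
    ring
  have ha := qFactorial_ne_zero a
  have hb := qFactorial_ne_zero b
  have hc := qFactorial_ne_zero c
  have hd := qFactorial_ne_zero d
  field_simp
  linear_combination pairingSum (-n) a b c * e

end
end QuantumSl2

/-- Within the range of summation `max(0, a - c) ≤ j ≤ min(a, b)` none of the subtractions of natural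
numbers is truncated, except that the lower bound `a - c` means `max(0, a - c)`. -/
theorem mainTheorem11 (a b c d : ℕ) (n : ℤ) (h : (a : ℤ) - b = (c : ℤ) - d) :
    semilinearForm (atWeight (Ediv a * Fdiv b) n) (atWeight (Ediv c * Fdiv d) n) =
      ∑ j ∈ Finset.Icc (a - c) (min a b),
        q ^ (2 * (j : ℤ) ^ 2 + ((a : ℤ) - d + n) * ((a : ℤ) - c - 2 * j)) *
          g (a - j) * g (b - j) * g j * g (c + j - a) ∧
    semilinearForm (atWeight (Fdiv b * Ediv a) n) (atWeight (Fdiv d * Ediv c) n) =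
      ∑ j ∈ Finset.Icc (a - c) (min a b),
        q ^ (2 * (j : ℤ) ^ 2 + ((b : ℤ) - c - n) * ((b : ℤ) - d - 2 * j)) *
          g (a - j) * g (b - j) * g j * g (c + j - a) := by
  constructor
  · rw [semilinearForm_EF a b c d n (by omega), pairingSum_eq_sum,
      show (b : ℤ) + c - a = d by omega]
  -- The roles of `a, b` and of `c, d` are exchanged. Since `a - c = b - d`, the range of summation
  -- is the same and the four factors `g` are merely permuted.
  · rw [semilinearForm_FE b a d c n (by omega), pairingSum_eq_sum,
      show (a : ℤ) + d - b = c by omega, show b - d = a - c by omega, min_comm]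
    refine Finset.sum_congr rfl fun j _ => ?_
    rw [show d + j - b = c + j - a by omega, ← sub_eq_add_neg, mul_right_comm _ (g (b - j))]
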